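/- **Theorem (Triangular Limit).** For $\lambda>0$ let $M_\lambda=([0,\lambda]\times[0,1])/\!\sim$ with $(0,y)\sim(\lambda,1-y)$ be the flat Moebius band; equivalently, $M_\lambda$ is the quotient of the strip $\mathbb R\times[0,1]$ by the group generated by $(x,y)\mapsto(x+\lambda,1-y)$. A *smooth embedded paper Moebius band of aspect ratio $\lambda$* is an injective map $I:M_\lambda\to\mathbb R^3$ that preserves the lengths of curves and is infinitely differentiable up to the boundary, i.e. for some $\varepsilon>0$ it extends to a $C^\infty$ map on $(\mathbb R\times(-\varepsilon,1+\varepsilon))/\langle(x,y)\mapsto(x+\lambda,1-y)\rangle$. For $j\in\mathbb Z$ let $v_j=(j/\sqrt3,0)$ if $j$ is even and $v_j=(j/\sqrt3,1)$ if $j$ is odd. The equilateral triangles $v_jv_{j+1}v_{j+2}$ of side $2/\sqrt3$ tile $\mathbb R\times[0,1]$, and three of them make up $M_{\sqrt3}$. Let $A_0=(-1/\sqrt3,0,0)$, $A_1=(1/\sqrt3,0,0)$, $A_2=(0,1,0)$, with indices read modulo $3$. The *triangular Moebius band* is given by the piecewise-linear map $J:M_{\sqrt3}\to\mathbb R^3$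 that sends the class of $v_j$ to $A_j$ and is affine on each triangle $v_jv_{j+1}v_{j+2}$. Let $I_n:M_{\lambda_n}\to\mathbb R^3$ $(n\in\mathbb N)$ be smooth embedded paper Moebius bands with $\lambda_n\to\sqrt3$. Then, up to isometries of $\mathbb R^3$ and of the flat bands $M_{\lambda_n}$, the maps $I_n$ converge uniformly to $J$. Precisely, let $\sigma_n:M_{\sqrt3}\to M_{\lambda_n}$ be the identification induced by $(x,y)\mapsto(\lambda_nx/\sqrt3,\,y)$. Then there are isometries $\Phi_n$ of $\mathbb R^3$ and isometries $\Psi_n$ of $M_{\lambda_n}$, the latter induced by maps $(x,y)\mapsto(\pm x+c_n,\,y)$ of the strip, such that $$\sup_{p\in M_{\sqrt3}}\bigl|\Phi_n\bigl(I_n(\Psi_n(\sigma_n(p)))\bigr)-J(p)\bigr|\longrightarrow 0\qquad(n\to\infty).$$ -/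

import Mathlib

open Set Filter Topology
open scoped ContDiff

noncomputable section

namespace PaperMoebius

/-- The Euclidean plane. -/
abbrev Plane : Type := EuclideanSpace ℝ (Fin 2)

/-- Euclidean three-space. -/
abbrev Space : Type := EuclideanSpace ℝ (Fin 3)

/-- The infinite closed strip `ℝ × [0,1]`, with the Euclidean distance of the plane. -/
abbrev Strip : Type := {p : Plane // p 1 ∈ Icc (0 : ℝ) 1}

/-- The point `(x, y)` of the strip. -/
def Strip.mk (x y : ℝ) (hy : y ∈ Icc (0 : ℝ) 1) : Strip :=
  ⟨!₂[x, y], by simpa using hy⟩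

theorem one_sub_mem {y : ℝ} (hy : y ∈ Icc (0 : ℝ) 1) : 1 - y ∈ Icc (0 : ℝ) 1 :=
  ⟨by linarith [hy.2], by linarith [hy.1]⟩

/-- The glide reflection `(x, y) ↦ (x + lam, 1 - y)` of the strip. -/
def glide (lam : ℝ) (p : Strip) : Strip :=
  Strip.mk (p.1 0 + lam) (1 - p.1 1) (one_sub_mem p.2)

/-- The flat Moebius band `M_lam` of width `1` and length `lam`: the quotient of the strip by the
equivalence relation generated by `(x, y) ∼ (x + lam, 1 - y)`. For `lam > 0` the rectangle
`[0, lam] × [0, 1]` is a fundamental domain, and the identification that remains on it is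
`(0, y) ∼ (lam, 1 - y)`. -/
def FlatMoebius (lam : ℝ) : Type := Quot fun p q : Strip => q = glide lam p

/-- The universal covering `ℝ × [0,1] → M_lam`. -/
def proj (lam : ℝ) (p : Strip) : FlatMoebius lam := Quot.mk _ p

/-- The open strip `ℝ × (-ε, 1 + ε)`, which covers the fattened open Moebius band. -/
def openStrip (ε : ℝ) : Set Plane := {p | -ε < p 1 ∧ p 1 < 1 + ε}

/-- `I` is infinitely differentiable on the manifold with boundary `M_lam`: for some `ε > 0` it
extends to a smooth map on the fattened band `ℝ × (-ε, 1 + ε) / (x, y) ∼ (x + lam, 1 - y)`. -/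
def IsSmooth (lam : ℝ) (I : FlatMoebius lam → Space) : Prop :=
  ∃ ε : ℝ, 0 < ε ∧ ∃ F : Plane → Space,
    ContDiffOn ℝ ∞ F (openStrip ε) ∧
    (∀ p ∈ openStrip ε, F !₂[p 0 + lam, 1 - p 1] = F p) ∧
    ∀ p : Strip, F p.1 = I (proj lam p)

/-- `I` is an isometric mapping: it preserves arc-lengths. Every curve in `M_lam` is the projection
of a curve in the strip, and the length of the former is the Euclidean length of the latter. -/
def PreservesArcLength (lam : ℝ) (I : FlatMoebius lam → Space) : Prop :=
  ∀ (γ : ℝ → Strip) (a b : ℝ), ContinuousOn γ (Icc a b) →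
    eVariationOn (fun t => I (proj lam (γ t))) (Icc a b) = eVariationOn γ (Icc a b)

/-- `I : M_lam → ℝ³` is a smooth embedded paper Moebius band of aspect ratio `lam`. -/
structure IsSmoothEmbeddedBand (lam : ℝ) (I : FlatMoebius lam → Space) : Prop where
  pos : 0 < lam
  smooth : IsSmooth lam I
  isometric : PreservesArcLength lam I
  embedded : Function.Injective I

/-- The isometry of the flat band `M_lam` induced by `(x, y) ↦ (± x + c, y)`. As the translation by
`lam` induces `(x, y) ↦ (x, 1 - y)`, these are all the isometries of `M_lam`. -/
def flatIsometry (lam : ℝ) (s : ℤˣ) (c : ℝ) : FlatMoebius lam → FlatMoebius lam :=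
  Quot.lift (fun p => proj lam (Strip.mk (((s : ℤ) : ℝ) * p.1 0 + c) (p.1 1) p.2)) (by
    rintro p q rfl
    rcases Int.units_eq_one_or s with rfl | rfl
    · refine Quot.sound (Subtype.ext ?_)
      simp only [glide, Strip.mk]
      ext i; fin_cases i <;> simp <;> ring
    · symm
      refine Quot.sound (Subtype.ext ?_)
      simp only [glide, Strip.mk]
      ext i; fin_cases i
      · simp; ring
      · simp)

/-- The affine identification `M_√3 → M_lam`, `(x, y) ↦ ((lam / √3) x, y)`. -/
def stretch (lam : ℝ) : FlatMoebius (√3) → FlatMoebius lam :=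
  Quot.lift (fun p => proj lam (Strip.mk (lam / √3 * p.1 0) (p.1 1) p.2)) (by
    rintro p q rfl
    refine Quot.sound (Subtype.ext ?_)
    simp only [glide, Strip.mk]
    ext i; fin_cases i
    · simp; field_simp
    · simp)

/-- The height of the vertex `v_j`. -/
def vertexHeight (j : ℤ) : ℝ := if Even j then 0 else 1

/-- The vertex `v_j = (j / √3, 0)` for `j` even, `(j / √3, 1)` for `j` odd. The triangles
`v_j v_{j+1} v_{j+2}`, for `j : ℤ`, are equilateral of side `2 / √3` and tile the strip; the glide
reflection of `M_√3` sends `v_j` to `v_{j+3}`. -/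
def vertex (j : ℤ) : Plane := !₂[(j : ℝ) / √3, vertexHeight j]

/-- The vertices `A_0, A_1, A_2` of an equilateral triangle of side `2 / √3` in `ℝ³`, with indices
read modulo `3`. -/
def corner (j : ℤ) : Space :=
  if j % 3 = 0 then !₂[-1 / √3, 0, 0] else if j % 3 = 1 then !₂[1 / √3, 0, 0] else !₂[0, 1, 0]

/-- The hat function of `v_j`: continuous, affine on each triangle `v_i v_{i+1} v_{i+2}`, equal to
`1` at `v_j` and to `0` at all other vertices. -/
def hat (j : ℤ) (p : Plane) : ℝ :=
  max 0 (min (1 - |p 1 - vertexHeight j|)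
    (1 - (|√3 * p 0 - j| + |p 1 - vertexHeight j|) / 2))

theorem vertexHeight_add_three (j : ℤ) : vertexHeight (j + 3) = 1 - vertexHeight j := by
  by_cases h : Even j <;> simp [vertexHeight, h, Int.even_add, show ¬ Even (3 : ℤ) by decide]

theorem hat_glide (j : ℤ) (p : Strip) : hat (j + 3) (glide (√3) p).1 = hat j p.1 := by
  have h3 : √3 * √3 = (3 : ℝ) := Real.mul_self_sqrt (by norm_num)
  have e2 : √3 * (p.1 0 + √3) - ((j : ℝ) + 3) = √3 * p.1 0 - j := by
    rw [mul_add, h3]; ring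
  simp only [hat, glide, Strip.mk, vertexHeight_add_three]
  simp [e2, abs_sub_comm (vertexHeight j)]

/-- The map of the strip that sends each `v_j` to `A_j` and is affine on each triangle
`v_j v_{j+1} v_{j+2}` (see `stripMap_affine`). -/
def stripMap (p : Plane) : Space := ∑ᶠ j : ℤ, hat j p • corner j

theorem stripMap_glide (p : Strip) : stripMap (glide (√3) p).1 = stripMap p.1 := by
  unfold stripMap
  rw [← finsum_comp_equiv (Equiv.addRight (3 : ℤ))]
  refine finsum_congr fun j => ?_
  simp only [Equiv.coe_addRight, hat_glide]
  congr 1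
  simp [corner]

/-- The piecewise-linear map `M_√3 → ℝ³` that gives the triangular Moebius band: `M_√3`
is the union of the three equilateral triangles `v_j v_{j+1} v_{j+2}`, `j = 0, 1, 2`, and each of
them is mapped by an affine isometry onto the same triangle `A_0 A_1 A_2`. -/
def triangularMap : FlatMoebius (√3) → Space :=
  Quot.lift (fun p => stripMap p.1) (by
    rintro p q rfl
    exact (stripMap_glide p).symm)

theorem vertexHeight_succ (j : ℤ) : vertexHeight (j + 1) = 1 - vertexHeight j := by
  by_cases h : Even j <;> simp [vertexHeight, h]

theorem stripMap_affine (j : ℤ) (a b c : ℝ) (ha : 0 ≤ a) (hb : 0 ≤ b) (hc : 0 ≤ c)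
    (h : a + b + c = 1) :
    stripMap (a • vertex j + b • vertex (j + 1) + c • vertex (j + 2)) =
      a • corner j + b • corner (j + 1) + c • corner (j + 2) := by
  have h3 : (√3 : ℝ) ≠ 0 := by positivity
  set p : Plane := a • vertex j + b • vertex (j + 1) + c • vertex (j + 2) with hp
  have e2 : vertexHeight (j + 2) = vertexHeight j := by
    rw [show j + 2 = (j + 1) + 1 by ring, vertexHeight_succ, vertexHeight_succ]; ring
  have p0 : √3 * p 0 = j + b + 2 * c := by
    have : p 0 = a * (j / √3) + b * ((j + 1) / √3) + c * ((j + 2) / √3) := by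
      simp [hp, vertex]
    rw [this]
    field_simp
    linear_combination (j : ℝ) * h
  have p1 : p 1 = (1 - b) * vertexHeight j + b * (1 - vertexHeight j) := by
    have : p 1 = a * vertexHeight j + b * vertexHeight (j + 1) + c * vertexHeight (j + 2) := by
      simp [hp, vertex]
    rw [this, vertexHeight_succ, e2]
    linear_combination vertexHeight j * h
  have hv : vertexHeight j = 0 ∨ vertexHeight j = 1 := by
    unfold vertexHeight; split_ifs <;> simp
  have dj : |p 1 - vertexHeight j| = b := by
    rcases hv with h0 | h0 <;> rw [p1, h0]
    · rw [abs_of_nonneg] <;> linarith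
    · rw [abs_of_nonpos] <;> linarith
  have dj1 : |p 1 - (1 - vertexHeight j)| = 1 - b := by
    rcases hv with h0 | h0 <;> rw [p1, h0]
    · rw [abs_of_nonpos] <;> linarith
    · rw [abs_of_nonneg] <;> linarith
  have t0 : hat j p = a := by
    rw [hat, dj, p0, show (j : ℝ) + b + 2 * c - j = b + 2 * c by ring,
      abs_of_nonneg (by linarith), min_eq_right (by linarith), max_eq_right (by linarith)]
    linarith
  have t1 : hat (j + 1) p = b := by
    have hx : |(j : ℝ) + b + 2 * c - ((j + 1 : ℤ) : ℝ)| ≤ 1 - b := by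
      push_cast
      rw [abs_le]; constructor <;> linarith
    rw [hat, vertexHeight_succ, dj1, p0, min_eq_left (by linarith), max_eq_right (by linarith)]
    ring
  have t2 : hat (j + 2) p = c := by
    have hx : |(j : ℝ) + b + 2 * c - ((j + 2 : ℤ) : ℝ)| = 2 - b - 2 * c := by
      push_cast
      rw [abs_of_nonpos] <;> linarith
    rw [hat, e2, dj, p0, hx, min_eq_right (by linarith), max_eq_right (by linarith)]
    ring
  have tz : ∀ i : ℤ, i ≠ j → i ≠ j + 1 → i ≠ j + 2 → hat i p = 0 := by
    intro i n0 n1 n2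
    refine max_eq_left (min_le_iff.2 (Or.inr ?_))
    rw [p0]
    have hd := abs_nonneg (p 1 - vertexHeight i)
    have h_up := le_abs_self ((j : ℝ) + b + 2 * c - i)
    have h_dn := neg_abs_le ((j : ℝ) + b + 2 * c - i)
    rcases (by omega : i = j - 1 ∨ i = j + 3 ∨ i ≤ j - 2 ∨ j + 4 ≤ i) with q | q | q | q
    · have hh : vertexHeight i = 1 - vertexHeight j := by
        have := vertexHeight_succ i
        rw [q, sub_add_cancel] at this
        rw [q]; linarith
      rw [hh, dj1]
      have qr : (i : ℝ) = j - 1 := by exact_mod_cast q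
      linarith
    · rw [q, vertexHeight_add_three, dj1, ← q]
      have qr : (i : ℝ) = j + 3 := by exact_mod_cast q
      linarith
    · have qr : (i : ℝ) ≤ j - 2 := by exact_mod_cast q
      linarith
    · have qr : (j : ℝ) + 4 ≤ i := by exact_mod_cast q
      linarith
  unfold stripMap
  rw [finsum_eq_sum_of_support_subset (s := {j, j + 1, j + 2})]
  · rw [Finset.sum_insert (by simp), Finset.sum_insert (by simp), Finset.sum_singleton,
      t0, t1, t2, add_assoc]
  · intro i hi
    by_contra hn
    simp only [Finset.coe_insert, Finset.coe_singleton, mem_insert_iff, mem_singleton_iff,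
      not_or] at hn
    exact hi (by simp only [tz i hn.1 hn.2.1 hn.2.2, zero_smul])

end PaperMoebius

end

/-! Lift a band to a map `F` of the strip. As a flat surface, `F` has all its second derivatives at
a point on one normal line, and they form a singular quadratic form (`gauss_equation`, `inner_det`).
Hence every bent point lies on a straight ruling along which the surface stays bent
(`ruling_propagates`, `bent_along_ruling`). A ruling cannot be horizontal, as `F` has period `2 *
lam` and would map it isometrically to a line; so it crosses the strip from edge to edge. Rulings do
not cross. Their closure, with the flat gaps filled by interpolated segments, gives a monotone
family of bends indexed by `s = a + b` and compatible with the glide (`exists_bends`).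

The vector `D s` of the bend changes sign under `s ↦ s + 2 * lam`. A lifting argument
(`exists_common_zero`) then yields two bends that are orthogonal and coplanar. By embeddedness they
do not cross, so the line of one misses the interior of the other, and an endpoint of the latter has
distance at least `1` from that line (`exists_triangle`).

This gives a triangle inscribed in the image of the boundary, of height at least `1` over a bend of
length `l = √(1 + t²)`, where `t = b - a`. The boundary loop is cut by the ends of the bend into
arcs of lengths `lam - t` and `lam + t`, with the apex on the second. Therefore `1 + t² ≤ (lam -
t)²` and `5 + t² ≤ (lam + t)²`, which traps `t` between `(5 - lam²) / (2 lam)` and `(lam² - 1) / (2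
lam)`. Both bounds tend to `1 / √3` as `lam → √3`; all inequalities become sharp and the triangle
becomes equilateral of side `2 / √3` (`tendsto_triangle_shape`).

So, after a translation of the strip and an isometry of space, the vertices `v_j` are sent near
`A_j`. Since the rescaled map is nearly `1`-Lipschitz and each triangle `v_j v_{j+1} v_{j+2}` is
congruent to its target, the images of the vertices determine the map up to a small uniform error
(`sq_dist_stripMap_le`). No compactness argument is needed: every estimate is explicit in `lam` and
in the error at the vertices. -/

noncomputable section

namespace PaperMoebius

/-! ### Calculus of directional derivatives -/

section DirectionalDerivative

variable {E G : Type*} [NormedAddCommGroup E] [NormedSpace ℝ E]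
  [NormedAddCommGroup G] [NormedSpace ℝ G] {U : Set E}

/-- The derivative of `f` at `x` in the direction `v`. -/
def dir (v : E) (f : E → G) (x : E) : G := fderiv ℝ f x v

theorem contDiffOn_dir (hU : IsOpen U) {f : E → G} (hf : ContDiffOn ℝ ∞ f U) (v : E) :
    ContDiffOn ℝ ∞ (dir v f) U :=
  (hf.fderiv_of_isOpen hU (by simp)).clm_apply contDiffOn_const

theorem differentiableAt_of_smooth (hU : IsOpen U) {f : E → G} (hf : ContDiffOn ℝ ∞ f U) {x : E}
    (hx : x ∈ U) : DifferentiableAt ℝ f x :=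
  (hf.contDiffAt (hU.mem_nhds hx)).differentiableAt (by simp)

theorem dir_comm (hU : IsOpen U) {f : E → G} (hf : ContDiffOn ℝ ∞ f U) {x : E} (hx : x ∈ U)
    (v w : E) : dir v (dir w f) x = dir w (dir v f) x := by
  have hd : DifferentiableAt ℝ (fderiv ℝ f) x :=
    differentiableAt_of_smooth hU (hf.fderiv_of_isOpen hU (by simp)) hx
  have key : ∀ a b : E, dir a (dir b f) x = fderiv ℝ (fderiv ℝ f) x a b := by
    intro a b
    have : HasFDerivAt (dir b f) ((ContinuousLinearMap.apply ℝ G b).comp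
        (fderiv ℝ (fderiv ℝ f) x)) x :=
      (ContinuousLinearMap.apply ℝ G b).hasFDerivAt.comp x hd.hasFDerivAt
    unfold dir at this ⊢
    rw [this.fderiv]
    rfl
  rw [key, key]
  exact ((hf.contDiffAt (hU.mem_nhds hx)).isSymmSndFDerivAt
    (by simp only [minSmoothness_of_isRCLikeNormedField]; exact WithTop.coe_le_coe.2 le_top)) v w

theorem dir_congr (hU : IsOpen U) {f g : E → G} (h : EqOn f g U) (v : E) :
    EqOn (dir v f) (dir v g) U := by
  intro x hx
  have : f =ᶠ[𝓝 x] g := h.eventuallyEq_of_mem (hU.mem_nhds hx)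
  simp only [dir, this.fderiv_eq]

theorem dir_const (v : E) (c : G) (x : E) : dir v (fun _ : E => c) x = 0 := by
  simp [dir]

theorem dir_add_left (v w : E) (f : E → G) (x : E) :
    dir (v + w) f x = dir v f x + dir w f x := by simp [dir]

theorem dir_smul_left (c : ℝ) (v : E) (f : E → G) (x : E) :
    dir (c • v) f x = c • dir v f x := by simp [dir]

theorem dir_add {f g : E → G} {x : E} (hf : DifferentiableAt ℝ f x)
    (hg : DifferentiableAt ℝ g x) (v : E) :
    dir v (fun y => f y + g y) x = dir v f x + dir v g x := by
  simp only [dir]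
  rw [fderiv_fun_add hf hg]; rfl

theorem dir_mul {f g : E → ℝ} {x : E} (hf : DifferentiableAt ℝ f x)
    (hg : DifferentiableAt ℝ g x) (v : E) :
    dir v (fun y => f y * g y) x = dir v f x * g x + f x * dir v g x := by
  simp only [dir]
  rw [fderiv_fun_mul hf hg]
  simp; ring

theorem dir_inner {W : Type*} [NormedAddCommGroup W] [InnerProductSpace ℝ W] {f g : E → W} {x : E}
    (hf : DifferentiableAt ℝ f x) (hg : DifferentiableAt ℝ g x) (v : E) :
    dir v (fun y => inner ℝ (f y) (g y)) x
      = inner ℝ (dir v f x) (g x) + inner ℝ (f x) (dir v g x) := by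
  simp only [dir]
  rw [fderiv_inner_apply ℝ hf hg, add_comm]

theorem hasDerivAt_line {f : E → G} {p v : E} {t : ℝ} (hf : DifferentiableAt ℝ f (p + t • v)) :
    HasDerivAt (fun s : ℝ => f (p + s • v)) (dir v f (p + t • v)) t := by
  have h : HasDerivAt (fun s : ℝ => p + s • v) v t := by
    simpa using ((hasDerivAt_id t).smul_const v).const_add p
  exact hf.hasFDerivAt.comp_hasDerivAt t h

end DirectionalDerivative

/-! ### Functions with singular Hessian: propagation along null directions -/

section Ruling

variable {E : Type*} [NormedAddCommGroup E] [NormedSpace ℝ E] {U : Set E}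

/-- First-order consequences of `u_vv u_ww = u_vw²`: the derivative of `u_vw` in the direction `v`
is a multiple of `u_vw` where `u_ww ≠ 0`. -/
theorem mixed_transport (hU : IsOpen U) {u : E → ℝ} (hu : ContDiffOn ℝ ∞ u U) (v w : E)
    (hdet : ∀ x ∈ U, dir v (dir v u) x * dir w (dir w u) x = dir v (dir w u) x ^ 2)
    {x : E} (hx : x ∈ U) (hP : dir w (dir w u) x ≠ 0) :
    dir v (dir v (dir w u)) x =
      (2 * dir w (dir v (dir w u)) x / dir w (dir w u) x
        - dir v (dir w u) x * dir w (dir w (dir w u)) x / dir w (dir w u) x ^ 2)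
        * dir v (dir w u) x := by
  have sm := fun {f : E → ℝ} (hf : ContDiffOn ℝ ∞ f U) (v : E) => contDiffOn_dir hU hf v
  have df := fun {f : E → ℝ} (hf : ContDiffOn ℝ ∞ f U) => differentiableAt_of_smooth hU hf hx
  have e1 : dir v (dir v (dir w u)) x = dir w (dir v (dir v u)) x := by
    rw [dir_comm hU (sm hu v) hx w v]
    exact dir_congr hU (fun y hy => dir_comm hU hu hy v w) v hx
  -- With `L = u_vv`, `M = u_vw`, `P = u_ww`: the `w`-derivative of `L P = M²` reads `M_v P + L P_w
  -- = 2 M M_w`, because `L_w = M_v`. Multiplying by `P` and replacing `L P` by `M²` gives the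
  -- claim.
  have e2 := dir_congr hU (f := fun y => dir v (dir v u) y * dir w (dir w u) y)
    (g := fun y => dir v (dir w u) y * dir v (dir w u) y)
    (fun y hy => by simpa [sq] using hdet y hy) w hx
  rw [dir_mul (df (sm (sm hu v) v)) (df (sm (sm hu w) w)),
    dir_mul (df (sm (sm hu w) v)) (df (sm (sm hu w) v))] at e2
  have e3 := hdet x hx
  rw [e1]
  field_simp
  linear_combination dir w (dir w u) x * e2 - dir w (dir w (dir w u)) x * e3

/-- Second-order consequence of `u_vv u_ww = u_vw²` at a point where `u_vw = 0 ≠ u_ww`. -/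
theorem mixed_transport_second (hU : IsOpen U) {u : E → ℝ} (hu : ContDiffOn ℝ ∞ u U) (v w : E)
    (hdet : ∀ x ∈ U, dir v (dir v u) x * dir w (dir w u) x = dir v (dir w u) x ^ 2)
    {x : E} (hx : x ∈ U) (hP : dir w (dir w u) x ≠ 0) (hM : dir v (dir w u) x = 0) :
    dir v (dir w (dir v (dir w u))) x * dir w (dir w u) x
      = 2 * dir w (dir v (dir w u)) x ^ 2 := by
  have sm := fun {f : E → ℝ} (hf : ContDiffOn ℝ ∞ f U) (v : E) => contDiffOn_dir hU hf v
  have df := fun {f : E → ℝ} (hf : ContDiffOn ℝ ∞ f U) {y : E} (hy : y ∈ U) =>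
    differentiableAt_of_smooth hU hf hy
  have e1 : EqOn (dir v (dir v (dir w u))) (dir w (dir v (dir v u))) U := by
    intro y hy
    rw [dir_comm hU (sm hu v) hy w v]
    exact dir_congr hU (fun y hy => dir_comm hU hu hy v w) v hy
  have e1' : dir v (dir w (dir v (dir w u))) x = dir w (dir w (dir v (dir v u))) x := by
    rw [dir_comm hU (sm (sm hu w) v) hx v w]
    exact dir_congr hU e1 w hx
  have e2 : EqOn
      (fun y => dir w (dir v (dir v u)) y * dir w (dir w u) y
        + dir v (dir v u) y * dir w (dir w (dir w u)) y)
      (fun y => dir w (dir v (dir w u)) y * dir v (dir w u) y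
        + dir v (dir w u) y * dir w (dir v (dir w u)) y) U := by
    intro y hy
    have := dir_congr hU (f := fun y => dir v (dir v u) y * dir w (dir w u) y)
      (g := fun y => dir v (dir w u) y * dir v (dir w u) y)
      (fun y hy => by simpa [sq] using hdet y hy) w hy
    rwa [dir_mul (df (sm (sm hu v) v) hy) (df (sm (sm hu w) w) hy),
      dir_mul (df (sm (sm hu w) v) hy) (df (sm (sm hu w) v) hy)] at this
  have dL := df (sm (sm hu v) v) hx
  have dP := df (sm (sm hu w) w) hx
  have dM := df (sm (sm hu w) v) hx
  have dLw := df (sm (sm (sm hu v) v) w) hx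
  have dPw := df (sm (sm (sm hu w) w) w) hx
  have dMw := df (sm (sm (sm hu w) v) w) hx
  have e3 := dir_congr hU e2 w hx
  rw [dir_add (dLw.fun_mul dP) (dL.fun_mul dPw),
    dir_add (dMw.fun_mul dM) (dM.fun_mul dMw),
    dir_mul dLw dP, dir_mul dL dPw, dir_mul dMw dM, dir_mul dM dMw] at e3
  -- At a zero of `M` with `P ≠ 0`, also `L` and `L_w` vanish, so only `L_ww P = 2 M_w²` survives in
  -- the second `w`-derivative of `L P = M²`.
  have hL : dir v (dir v u) x = 0 := by
    have := hdet x hx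
    rw [hM] at this
    simpa [hP] using this
  have hLw : dir w (dir v (dir v u)) x = 0 := by
    have := e2 hx
    simp only [hM, hL] at this
    simpa [hP] using this
  rw [hL, hLw, hM] at e3
  rw [e1']
  linear_combination e3

/-- If `u_vv u_ww = u_vw²` on `U` and `u_vw = 0 ≠ u_ww` at `p`, then the same holds along the
segment that issues from `p` in the direction `v`, as far as it stays in `U`. -/
theorem ruling_propagates (hU : IsOpen U) {u : E → ℝ} (hu : ContDiffOn ℝ ∞ u U) (v w : E)
    (hdet : ∀ x ∈ U, dir v (dir v u) x * dir w (dir w u) x = dir v (dir w u) x ^ 2)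
    {p : E} {T : ℝ} (hp : ∀ t ∈ Icc 0 T, p + t • v ∈ U)
    (hM : dir v (dir w u) p = 0) (hP : dir w (dir w u) p ≠ 0) :
    ∀ t ∈ Icc 0 T, dir v (dir w u) (p + t • v) = 0 ∧ dir w (dir w u) (p + t • v) ≠ 0 := by
  have sm := fun {f : E → ℝ} (hf : ContDiffOn ℝ ∞ f U) (v : E) => contDiffOn_dir hU hf v
  have hd : ∀ {f : E → ℝ}, ContDiffOn ℝ ∞ f U → ∀ t ∈ Icc 0 T,
      HasDerivAt (fun s : ℝ => f (p + s • v)) (dir v f (p + t • v)) t := fun hf t ht =>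
    hasDerivAt_line (differentiableAt_of_smooth hU hf (hp t ht))
  have hc : ∀ {f : E → ℝ}, ContDiffOn ℝ ∞ f U →
      ContinuousOn (fun s : ℝ => f (p + s • v)) (Icc 0 T) := fun hf t ht =>
    (hd hf t ht).continuousAt.continuousWithinAt
  have cM := sm (sm hu w) v
  have cP := sm (sm hu w) w
  -- While `P ≠ 0`, `M` solves a linear equation `M' = κ(t) M` with `κ` bounded, and it starts at
  -- `0`: Gronwall.
  have stepA : ∀ t₁ ≤ T, (∀ t ∈ Icc 0 t₁, dir w (dir w u) (p + t • v) ≠ 0) →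
      ∀ t ∈ Icc 0 t₁, dir v (dir w u) (p + t • v) = 0 := by
    intro t₁ ht₁ hne
    have sub : Icc 0 t₁ ⊆ Icc 0 T := Icc_subset_Icc_right ht₁
    have cc : ContinuousOn (fun t : ℝ =>
        2 * dir w (dir v (dir w u)) (p + t • v) / dir w (dir w u) (p + t • v)
        - dir v (dir w u) (p + t • v) * dir w (dir w (dir w u)) (p + t • v)
          / dir w (dir w u) (p + t • v) ^ 2) (Icc 0 t₁) :=
      (((continuousOn_const.mul ((hc (sm cM w)).mono sub)).div ((hc cP).mono sub) hne)).sub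
        ((((hc cM).mono sub).mul ((hc (sm cP w)).mono sub)).div
          (((hc cP).mono sub).pow 2) fun t ht => pow_ne_zero 2 (hne t ht))
    obtain ⟨K, hK⟩ := isCompact_Icc.exists_bound_of_continuousOn cc
    refine eq_zero_of_abs_deriv_le_mul_abs_self_of_eq_zero_right (K := K)
      (f' := fun t => dir v (dir v (dir w u)) (p + t • v)) ((hc cM).mono sub)
      (fun t ht => (hd cM t (sub (Ico_subset_Icc_self ht))).hasDerivWithinAt) (by simpa using hM) ?_
    intro t ht
    have ht' := Ico_subset_Icc_self ht
    rw [mixed_transport hU hu v w hdet (hp t (sub ht')) (hne t ht'), norm_mul]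
    exact mul_le_mul_of_nonneg_right (hK t ht') (norm_nonneg _)
  set k : ℝ := dir w (dir v (dir w u)) p / dir w (dir w u) p ^ 2 with hk
  -- Where `M = 0`, `P' = M_w` and `M_w' P = 2 M_w²`. Hence `M_w / P²` is constant and `1 / P` is an
  -- affine function of `t`.
  have stepB : ∀ t₁ ≤ T, (∀ t ∈ Icc 0 t₁, dir w (dir w u) (p + t • v) ≠ 0) →
      ∀ t ∈ Icc 0 t₁, (dir w (dir w u) (p + t • v))⁻¹ = (dir w (dir w u) p)⁻¹ - t * k := by
    intro t₁ ht₁ hne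
    have sub : Icc 0 t₁ ⊆ Icc 0 T := Icc_subset_Icc_right ht₁
    have hM0 := stepA t₁ ht₁ hne
    have hPv : ∀ t ∈ Icc 0 t₁, dir v (dir w (dir w u)) (p + t • v)
        = dir w (dir v (dir w u)) (p + t • v) := fun t ht =>
      dir_comm hU (sm hu w) (hp t (sub ht)) v w
    have hK : ∀ t ∈ Icc 0 t₁, dir w (dir v (dir w u)) (p + t • v)
        / dir w (dir w u) (p + t • v) ^ 2 = k := by
      have := constant_of_has_deriv_right_zero
        (f := fun t : ℝ => dir w (dir v (dir w u)) (p + t • v)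
          / dir w (dir w u) (p + t • v) ^ 2) (a := 0) (b := t₁)
        (((hc (sm cM w)).mono sub).div (((hc cP).mono sub).pow 2)
          fun t ht => pow_ne_zero 2 (hne t ht)) ?_
      · intro t ht
        have h0 := this t ht
        simpa [hk] using h0
      · intro t ht
        have ht' := Ico_subset_Icc_self ht
        have h1 := ((hd (sm cM w) t (sub ht')).div ((hd cP t (sub ht')).pow 2)
          (pow_ne_zero 2 (hne t ht'))).hasDerivWithinAt (s := Ici t)
        convert h1 using 1
        · rfl
        have h2 := mixed_transport_second hU hu v w hdet (hp t (sub ht')) (hne t ht') (hM0 t ht')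
        rw [hPv t ht']
        have := hne t ht'
        symm
        rw [div_eq_zero_iff]
        left
        simp only [Pi.pow_apply]
        push_cast
        linear_combination dir w (dir w u) (p + t • v) * h2
    intro t ht
    have h0 := constant_of_has_deriv_right_zero
      (f := fun t : ℝ => (dir w (dir w u) (p + t • v))⁻¹ + t * k) (a := 0) (b := t₁)
      ((((hc cP).mono sub).inv₀ hne).add (by fun_prop)) (by
        intro t ht
        have ht' := Ico_subset_Icc_self ht
        have h1 := (((hd cP t (sub ht')).inv (hne t ht')).add
          ((hasDerivAt_id t).mul_const k)).hasDerivWithinAt (s := Ici t)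
        convert h1 using 1
        · rfl
        rw [hPv t ht', ← hK t ht']
        ring) t ht
    simp only [zero_smul, add_zero, zero_mul] at h0
    linarith
  -- An affine `1 / P` stays bounded, so `P` has no first zero: at such a `τ` the product of `P`
  -- with the affine function would be both `0` and the limit of `1`.
  have hP_all : ∀ t ∈ Icc 0 T, dir w (dir w u) (p + t • v) ≠ 0 := by
    by_contra! hcon
    obtain ⟨t₂, ht₂, hz⟩ := hcon
    set Z : Set ℝ := Icc 0 T ∩ (fun s : ℝ => dir w (dir w u) (p + s • v)) ⁻¹' {0} with hZ
    have hZc : IsClosed Z := (hc cP).preimage_isClosed_of_isClosed isClosed_Icc isClosed_singleton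
    have hZb : BddBelow Z := ⟨0, fun s hs => hs.1.1⟩
    have hmem : sInf Z ∈ Z := hZc.csInf_mem ⟨t₂, ht₂, hz⟩ hZb
    set τ := sInf Z with hτ
    have hτ0 : 0 < τ := by
      rcases hmem.1.1.eq_or_lt with h | h
      · exfalso
        have := hmem.2
        rw [← h] at this
        simp only [mem_preimage, zero_smul, add_zero, mem_singleton_iff] at this
        exact hP this
      · exact h
    have hbelow : ∀ t ∈ Ico 0 τ, dir w (dir w u) (p + t • v) ≠ 0 := fun t ht h =>
      absurd (csInf_le hZb (show t ∈ Z from ⟨⟨ht.1, ht.2.le.trans hmem.1.2⟩, h⟩)) (not_le.2 ht.2)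
    have hprod : ∀ t ∈ Ico 0 τ,
        dir w (dir w u) (p + t • v) * ((dir w (dir w u) p)⁻¹ - t * k) = 1 := by
      intro t ht
      rw [← stepB t (ht.2.le.trans hmem.1.2)
        (fun s hs => hbelow s ⟨hs.1, hs.2.trans_lt ht.2⟩) t ⟨ht.1, le_rfl⟩]
      exact mul_inv_cancel₀ (hbelow t ht)
    have hcont : ContinuousWithinAt (fun t : ℝ => dir w (dir w u) (p + t • v)
        * ((dir w (dir w u) p)⁻¹ - t * k)) (Iio τ) τ :=
      ((hd cP τ hmem.1).continuousAt.mul (by fun_prop)).continuousWithinAt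
    have hlim : Tendsto (fun t : ℝ => dir w (dir w u) (p + t • v)
        * ((dir w (dir w u) p)⁻¹ - t * k)) (𝓝[<] τ) (𝓝 1) := by
      refine tendsto_const_nhds.congr' ?_
      filter_upwards [Ioo_mem_nhdsLT hτ0] with t ht
      exact (hprod t ⟨ht.1.le, ht.2⟩).symm
    have h01 := tendsto_nhds_unique hcont hlim
    have hz' : dir w (dir w u) (p + τ • v) = 0 := hmem.2
    simp [hz'] at h01
  exact fun t ht => ⟨stepA T le_rfl hP_all t ht, hP_all t ht⟩

end Ruling

/-! ### Second fundamental form of a flat surface -/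

section IsometricImmersion

variable {U : Set Plane} {F : Plane → Space}

/-- `F` has a nonzero second derivative at `p`. -/
def Bent (F : Plane → Space) (p : Plane) : Prop := ∃ v w, dir v (dir w F) p ≠ 0

theorem inner_dir_dir {p : Plane} (hiso : ∀ v, ‖dir v F p‖ = ‖v‖) (v w : Plane) :
    inner ℝ (dir v F p) (dir w F p) = inner ℝ v w := by
  have h := hiso (v + w)
  rw [dir_add_left] at h
  have h1 := norm_add_sq_real (dir v F p) (dir w F p)
  have h2 := norm_add_sq_real v w
  rw [h, hiso, hiso] at h1
  linarith

/-- The trilinear form is symmetric in `z, v` by Schwarz and antisymmetric in `v, w`, since `⟨F_v,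
F_w⟩` is constant. Such a form is zero. Thus second derivatives are normal to the surface. -/
theorem inner_dir_dir_dir (hU : IsOpen U) (hF : ContDiffOn ℝ ∞ F U)
    (hiso : ∀ p ∈ U, ∀ v, ‖dir v F p‖ = ‖v‖) {p : Plane} (hp : p ∈ U) (z v w : Plane) :
    inner ℝ (dir z (dir v F) p) (dir w F p) = 0 := by
  have hd := fun v => differentiableAt_of_smooth hU (contDiffOn_dir hU hF v) hp
  have anti : ∀ z v w, inner ℝ (dir z (dir v F) p) (dir w F p)
      = - inner ℝ (dir z (dir w F) p) (dir v F p) := by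
    intro z v w
    have h := dir_congr hU (f := fun y => inner ℝ (dir v F y) (dir w F y))
      (g := fun _ => inner ℝ v w) (fun y hy => inner_dir_dir (hiso y hy) v w) z hp
    rw [dir_inner (hd v) (hd w), dir_const] at h
    rw [real_inner_comm (dir v F p) (dir z (dir w F) p)]
    linarith
  have sym : ∀ z v w, inner ℝ (dir z (dir v F) p) (dir w F p)
      = inner ℝ (dir v (dir z F) p) (dir w F p) := fun z v w => by
    rw [dir_comm hU hF hp]
  have h1 := anti z v w
  have h2 := sym z w v
  have h3 := anti w z v
  have h4 := sym w v z
  have h5 := anti v w z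
  have h6 := sym z v w
  linarith

/-- The Gauss equation of a flat surface. -/
theorem gauss_equation (hU : IsOpen U) (hF : ContDiffOn ℝ ∞ F U)
    (hiso : ∀ p ∈ U, ∀ v, ‖dir v F p‖ = ‖v‖) {p : Plane} (hp : p ∈ U) (v w : Plane) :
    inner ℝ (dir v (dir v F) p) (dir w (dir w F) p)
      = inner ℝ (dir v (dir w F) p) (dir v (dir w F) p) := by
  have sm := fun {f : Plane → Space} (hf : ContDiffOn ℝ ∞ f U) (v : Plane) =>
    contDiffOn_dir hU hf v
  have df := fun {f : Plane → Space} (hf : ContDiffOn ℝ ∞ f U) =>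
    differentiableAt_of_smooth hU hf hp
  -- Differentiating `⟨F_vv, F_w⟩ = 0` along `w` and `⟨F_vw, F_w⟩ = 0` along `v` produces the same
  -- third-order term; it cancels in the difference.
  have h1 := dir_congr hU (f := fun y => inner ℝ (dir v (dir v F) y) (dir w F y))
    (g := fun _ => (0 : ℝ)) (fun y hy => inner_dir_dir_dir hU hF hiso hy v v w) w hp
  have h2 := dir_congr hU (f := fun y => inner ℝ (dir v (dir w F) y) (dir w F y))
    (g := fun _ => (0 : ℝ)) (fun y hy => inner_dir_dir_dir hU hF hiso hy v w w) v hp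
  rw [dir_inner (df (sm (sm hF v) v)) (df (sm hF w)), dir_const] at h1
  rw [dir_inner (df (sm (sm hF w) v)) (df (sm hF w)), dir_const] at h2
  have e1 : dir w (dir v (dir v F)) p = dir v (dir v (dir w F)) p := by
    rw [dir_comm hU (sm hF v) hp w v]
    exact dir_congr hU (fun y hy => dir_comm hU hF hy w v) v hp
  rw [e1] at h1
  linarith

theorem exists_normal (hU : IsOpen U) (hF : ContDiffOn ℝ ∞ F U)
    (hiso : ∀ p ∈ U, ∀ v, ‖dir v F p‖ = ‖v‖) {p : Plane} (hp : p ∈ U) :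
    ∃ n : Space, n ≠ 0 ∧ ∀ v w, ∃ c : ℝ, dir v (dir w F) p = c • n := by
  set K : Submodule ℝ Space := LinearMap.range (fderiv ℝ F p : Plane →ₗ[ℝ] Space) with hK
  have hinj : Function.Injective (fderiv ℝ F p : Plane →ₗ[ℝ] Space) := by
    rw [← LinearMap.ker_eq_bot, LinearMap.ker_eq_bot']
    intro v hv
    have : ‖dir v F p‖ = 0 := by rw [norm_eq_zero]; exact hv
    rw [hiso p hp] at this
    exact norm_eq_zero.1 this
  have h2 : Module.finrank ℝ K = 2 := by
    rw [hK, LinearMap.finrank_range_of_inj hinj]; simp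
  have h1 : Module.finrank ℝ Kᗮ = 1 := by
    have := K.finrank_add_finrank_orthogonal
    simp only [h2, finrank_euclideanSpace, Fintype.card_fin] at this
    omega
  obtain ⟨n, hn0, hn⟩ := finrank_eq_one_iff'.1 h1
  refine ⟨n, by simpa using hn0, fun v w => ?_⟩
  have hmem : dir v (dir w F) p ∈ Kᗮ := by
    rw [Submodule.mem_orthogonal']
    rintro _ ⟨z, rfl⟩
    exact inner_dir_dir_dir hU hF hiso hp v w z
  obtain ⟨c, hc⟩ := hn ⟨_, hmem⟩
  exact ⟨c, by simpa using (congrArg Subtype.val hc).symm⟩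

/-- The Hessian of each component of `F` is singular. -/
theorem inner_det (hU : IsOpen U) (hF : ContDiffOn ℝ ∞ F U)
    (hiso : ∀ p ∈ U, ∀ v, ‖dir v F p‖ = ‖v‖) {p : Plane} (hp : p ∈ U) (e : Space) (v w : Plane) :
    inner ℝ e (dir v (dir v F) p) * inner ℝ e (dir w (dir w F) p)
      = inner ℝ e (dir v (dir w F) p) ^ 2 := by
  obtain ⟨n, hn0, hn⟩ := exists_normal hU hF hiso hp
  obtain ⟨a, ha⟩ := hn v v
  obtain ⟨b, hb⟩ := hn v w
  obtain ⟨c, hc⟩ := hn w w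
  have hg := gauss_equation hU hF hiso hp v w
  rw [ha, hb, hc] at hg ⊢
  simp only [real_inner_smul_left, real_inner_smul_right] at hg ⊢
  have hnn : inner ℝ n n ≠ 0 := by simpa using hn0
  have : a * c = b * b := by
    apply mul_right_cancel₀ hnn
    linarith
  linear_combination (inner ℝ e n) ^ 2 * this

/-- All second derivatives at `p` are multiples of one normal vector. If `e` is not orthogonal to
one of them, it is not orthogonal to that normal, and so detects every nonzero one. -/
theorem dir_dir_eq_zero_of_inner (hU : IsOpen U) (hF : ContDiffOn ℝ ∞ F U)
    (hiso : ∀ p ∈ U, ∀ v, ‖dir v F p‖ = ‖v‖) {p : Plane} (hp : p ∈ U) {e : Space} {a b v w : Plane}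
    (hab : inner ℝ e (dir a (dir b F) p) ≠ 0) (h : inner ℝ e (dir v (dir w F) p) = 0) :
    dir v (dir w F) p = 0 := by
  obtain ⟨n, hn0, hn⟩ := exists_normal hU hF hiso hp
  obtain ⟨c, hc⟩ := hn a b
  obtain ⟨d, hd⟩ := hn v w
  rw [hc, real_inner_smul_right] at hab
  rw [hd, real_inner_smul_right] at h
  have : d = 0 := by
    rcases mul_eq_zero.1 h with h | h
    · exact h
    · exact absurd h (right_ne_zero_of_mul hab)
  rw [hd, this, zero_smul]

/-- An asymptotic direction lies in the kernel of the second fundamental form: apply `inner_det`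
with `e` equal to the mixed derivative itself. -/
theorem dir_dir_eq_zero_of_self (hU : IsOpen U) (hF : ContDiffOn ℝ ∞ F U)
    (hiso : ∀ p ∈ U, ∀ v, ‖dir v F p‖ = ‖v‖) {p : Plane} (hp : p ∈ U) {v : Plane}
    (h : dir v (dir v F) p = 0) (w : Plane) : dir v (dir w F) p = 0 := by
  have := inner_det hU hF hiso hp (dir v (dir w F) p) v w
  rw [h, inner_zero_right, zero_mul] at this
  have h2 := pow_eq_zero_iff (two_ne_zero) |>.1 this.symm
  exact inner_self_eq_zero.1 h2

theorem dir_dir_add_smul {f : Plane → Space} (hU : IsOpen U) (hf : ContDiffOn ℝ ∞ f U) {p : Plane}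
    (hp : p ∈ U) (z v w : Plane) (a b : ℝ) :
    dir z (dir (a • v + b • w) f) p = a • dir z (dir v f) p + b • dir z (dir w f) p := by
  rw [dir_comm hU hf hp, dir_add_left, dir_smul_left, dir_smul_left, dir_comm hU hf hp v,
    dir_comm hU hf hp w]

theorem exists_self_ne_zero_of_bent (hU : IsOpen U) (hF : ContDiffOn ℝ ∞ F U)
    (hiso : ∀ p ∈ U, ∀ v, ‖dir v F p‖ = ‖v‖) {p : Plane} (hp : p ∈ U) (hb : Bent F p) :
    ∃ w, dir w (dir w F) p ≠ 0 := by
  by_contra! h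
  obtain ⟨v, w, hvw⟩ := hb
  exact hvw (dir_dir_eq_zero_of_self hU hF hiso hp (h v) w)

theorem exists_asymptotic_direction (hU : IsOpen U) (hF : ContDiffOn ℝ ∞ F U)
    (hiso : ∀ p ∈ U, ∀ v, ‖dir v F p‖ = ‖v‖) {p : Plane} (hp : p ∈ U) :
    ∃ v, v ≠ 0 ∧ dir v (dir v F) p = 0 := by
  set e₀ : Plane := !₂[1, 0] with he₀
  set e₁ : Plane := !₂[0, 1] with he₁
  by_cases h0 : dir e₀ (dir e₀ F) p = 0
  · refine ⟨e₀, fun h => ?_, h0⟩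
    have := congrArg (fun q : Plane => q 0) h
    simp [he₀] at this
  obtain ⟨n, hn0, hn⟩ := exists_normal hU hF hiso hp
  obtain ⟨a, ha⟩ := hn e₀ e₀
  obtain ⟨b, hb⟩ := hn e₀ e₁
  obtain ⟨c, hc⟩ := hn e₁ e₁
  have hb' : dir e₁ (dir e₀ F) p = b • n := by rw [dir_comm hU hF hp, hb]
  have ha0 : a ≠ 0 := by rintro rfl; exact h0 (by rw [ha, zero_smul])
  have hdet : a * c = b * b := by
    have := gauss_equation hU hF hiso hp e₀ e₁
    rw [ha, hb, hc] at this
    simp only [real_inner_smul_left, real_inner_smul_right] at this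
    apply mul_right_cancel₀ (show inner ℝ n n ≠ 0 by simpa using hn0)
    linarith
  -- `(-b, a)` spans the kernel of the singular matrix with rows `(a, b)` and `(b, c)`.
  refine ⟨(-b) • e₀ + a • e₁, fun h => ha0 ?_, ?_⟩
  · have := congrArg (fun q : Plane => q 1) h
    simpa [he₀, he₁] using this
  · rw [dir_dir_add_smul hU hF hp, dir_add_left, dir_add_left]
    simp only [dir_smul_left, ha, hb, hb', hc, smul_smul, ← add_smul]
    convert zero_smul ℝ n using 2
    linear_combination a * hdet

/-- Two different slopes give a basis of the plane, and both basis vectors lie in the kernel of the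
second fundamental form. -/
theorem not_bent_of_two_directions (hU : IsOpen U) (hF : ContDiffOn ℝ ∞ F U)
    (hiso : ∀ p ∈ U, ∀ v, ‖dir v F p‖ = ‖v‖) {p : Plane} (hp : p ∈ U) {σ τ : ℝ} (hne : σ ≠ τ)
    (h₁ : dir !₂[σ, 1] (dir !₂[σ, 1] F) p = 0) (h₂ : dir !₂[τ, 1] (dir !₂[τ, 1] F) p = 0) :
    ¬ Bent F p := by
  rintro ⟨v, w, hvw⟩
  apply hvw
  have k₁ := dir_dir_eq_zero_of_self hU hF hiso hp h₁ w
  have k₂ := dir_dir_eq_zero_of_self hU hF hiso hp h₂ w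
  have hst : σ - τ ≠ 0 := sub_ne_zero.2 hne
  have hv : v = ((v 0 - τ * v 1) / (σ - τ)) • (!₂[σ, 1] : Plane)
      + ((σ * v 1 - v 0) / (σ - τ)) • (!₂[τ, 1] : Plane) := by
    ext i
    fin_cases i
    · simp; field_simp; ring
    · simp; field_simp; ring
  rw [hv, dir_add_left, dir_smul_left, dir_smul_left, k₁, k₂]
  simp

/-- The rulings of a bent flat surface are straight, and the surface stays bent along them. -/
theorem bent_along_ruling (hU : IsOpen U) (hF : ContDiffOn ℝ ∞ F U)
    (hiso : ∀ p ∈ U, ∀ v, ‖dir v F p‖ = ‖v‖) {p v : Plane} {T : ℝ}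
    (hseg : ∀ t ∈ Icc 0 T, p + t • v ∈ U) (hp : p ∈ U) (hb : Bent F p)
    (hv : dir v (dir v F) p = 0) :
    ∀ t ∈ Icc 0 T, Bent F (p + t • v) ∧ dir v (dir v F) (p + t • v) = 0 := by
  obtain ⟨w, hw⟩ := exists_self_ne_zero_of_bent hU hF hiso hp hb
  set e := dir w (dir w F) p with he
  -- Projection to the fixed vector `e = F_ww(p)` reduces the claim to the scalar
  -- `ruling_propagates`. Where `u_ww ≠ 0`, `e` still detects every second derivative of `F`.
  set u : Plane → ℝ := fun x => inner ℝ e (F x) with hu_def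
  have hu : ContDiffOn ℝ ∞ u U := contDiffOn_const.inner ℝ hF
  have hd : ∀ {f : Plane → Space}, ContDiffOn ℝ ∞ f U → ∀ a : Plane,
      EqOn (dir a (fun x => inner ℝ e (f x))) (fun x => inner ℝ e (dir a f x)) U := by
    intro f hf a x hx
    rw [dir_inner (differentiableAt_const e) (differentiableAt_of_smooth hU hf hx), dir_const,
      inner_zero_left, zero_add]
  have hdd : ∀ (a b : Plane) {x : Plane}, x ∈ U →
      dir a (dir b u) x = inner ℝ e (dir a (dir b F) x) := fun a b x hx => by
    rw [dir_congr hU (hd hF b) a hx, hd (contDiffOn_dir hU hF b) a hx]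
  have key := ruling_propagates hU hu v w (fun x hx => by
    rw [hdd v v hx, hdd w w hx, hdd v w hx]
    exact inner_det hU hF hiso hx e v w) hseg
    (by rw [hdd v w hp, dir_dir_eq_zero_of_self hU hF hiso hp hv w, inner_zero_right])
    (by rw [hdd w w hp, ← he]; simpa using hw)
  intro t ht
  obtain ⟨k1, k2⟩ := key t ht
  have hq := hseg t ht
  rw [hdd _ _ hq] at k1 k2
  refine ⟨⟨w, w, fun h => k2 (by rw [h, inner_zero_right])⟩, ?_⟩
  refine dir_dir_eq_zero_of_inner hU hF hiso hq k2 ?_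
  have := inner_det hU hF hiso hq e v w
  rw [k1] at this
  simpa [k2] using this

end IsometricImmersion

/-! ### Developing maps on the strip and their rulings -/

/-- The open strip `ℝ × (0, 1)`. -/
def interiorStrip : Set Plane := {p | 0 < p 1 ∧ p 1 < 1}

/-- The closed strip `ℝ × [0, 1]`. -/
def closedStrip : Set Plane := {p | p 1 ∈ Icc (0 : ℝ) 1}

theorem isOpen_interiorStrip : IsOpen interiorStrip :=
  (isOpen_lt continuous_const (by fun_prop : Continuous fun p : Plane => p 1)).inter
    (isOpen_lt (by fun_prop : Continuous fun p : Plane => p 1) continuous_const)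

theorem interiorStrip_subset : interiorStrip ⊆ closedStrip := fun _ hp => ⟨hp.1.le, hp.2.le⟩

/-- The lift to the strip of an isometric map `M_lam → ℝ³` that is smooth in the interior. -/
structure IsDevelopingMap (lam : ℝ) (F : Plane → Space) : Prop where
  pos : 0 < lam
  smooth : ContDiffOn ℝ ∞ F interiorStrip
  lipschitz : ∀ p ∈ closedStrip, ∀ q ∈ closedStrip, dist (F p) (F q) ≤ dist p q
  isometric : ∀ p ∈ interiorStrip, ∀ v, ‖dir v F p‖ = ‖v‖
  periodic : ∀ p ∈ closedStrip, F !₂[p 0 + lam, 1 - p 1] = F p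

/-- The point of height `y` on the line through `(a, 0)` and `(b, 1)`. -/
def chord (a b y : ℝ) : Plane := !₂[(1 - y) * a + y * b, y]

@[simp] theorem chord_zero_coord (a b y : ℝ) : chord a b y 0 = (1 - y) * a + y * b := by
  simp [chord]

@[simp] theorem chord_one_coord (a b y : ℝ) : chord a b y 1 = y := by simp [chord]

theorem chord_add (a b y t : ℝ) :
    chord a b y + t • (!₂[b - a, 1] : Plane) = chord a b (y + t) := by
  ext i
  fin_cases i
  · simp [chord]; ring
  · simp [chord]

theorem chord_mem {a b y : ℝ} (hy : y ∈ Ioo (0 : ℝ) 1) : chord a b y ∈ interiorStrip := by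
  simpa [interiorStrip] using hy

/-- The segment from `(a, 0)` to `(b, 1)` is mapped isometrically to a straight segment. -/
def IsBend (F : Plane → Space) (a b : ℝ) : Prop :=
  dist (F !₂[a, 0]) (F !₂[b, 1]) = dist (!₂[a, 0] : Plane) !₂[b, 1]

/-- The segment from `(a, 0)` to `(b, 1)` is a ruling along which the surface is bent. -/
def IsRuling (F : Plane → Space) (a b : ℝ) : Prop :=
  ∀ y ∈ Ioo (0 : ℝ) 1, Bent F (chord a b y) ∧
    dir !₂[b - a, 1] (dir !₂[b - a, 1] F) (chord a b y) = 0

namespace IsDevelopingMap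

variable {lam : ℝ} {F : Plane → Space}

theorem continuousOn (h : IsDevelopingMap lam F) : ContinuousOn F closedStrip :=
  (LipschitzOnWith.of_dist_le_mul (K := 1) fun p hp q hq => by
    simpa using h.lipschitz p hp q hq).continuousOn

/-- `F_vv = 0` makes `F_v` constant along the open segment, so `F` is affine there with a velocity
of norm `‖v‖`. Continuity extends this to endpoints on the boundary of the strip, where nothing is
assumed about derivatives. -/
theorem dist_eq_of_straight (h : IsDevelopingMap lam F) {p v : Plane} {T : ℝ} (hT : 0 < T)
    (hc : ∀ t ∈ Icc 0 T, p + t • v ∈ closedStrip)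
    (hi : ∀ t ∈ Ioo 0 T, p + t • v ∈ interiorStrip)
    (hv : ∀ t ∈ Ioo 0 T, dir v (dir v F) (p + t • v) = 0) :
    dist (F p) (F (p + T • v)) = T * ‖v‖ := by
  have hd : ∀ {f : Plane → Space}, ContDiffOn ℝ ∞ f interiorStrip → ∀ t ∈ Ioo 0 T,
      HasDerivAt (fun s : ℝ => f (p + s • v)) (dir v f (p + t • v)) t := fun hf t ht =>
    hasDerivAt_line (differentiableAt_of_smooth isOpen_interiorStrip hf (hi t ht))
  have sm := contDiffOn_dir isOpen_interiorStrip h.smooth v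
  have hm : T / 2 ∈ Ioo 0 T := ⟨by linarith, by linarith⟩
  set c := dir v F (p + (T / 2) • v) with hc_def
  have h1 : ∀ t ∈ Ioo 0 T, dir v F (p + t • v) = c := by
    intro t ht
    refine isOpen_Ioo.is_const_of_deriv_eq_zero isPreconnected_Ioo
      (f := fun s : ℝ => dir v F (p + s • v))
      (fun s hs => (hd sm s hs).differentiableAt.differentiableWithinAt) ?_ ht hm
    intro s hs
    rw [(hd sm s hs).deriv, hv s hs]; rfl
  have hg : ∀ t ∈ Ioo 0 T, HasDerivAt (fun s : ℝ => F (p + s • v) - s • c) 0 t := by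
    intro t ht
    have : HasDerivAt (fun s : ℝ => F (p + s • v) - s • c) (dir v F (p + t • v) - (1 : ℝ) • c) t :=
      (hd h.smooth t ht).sub ((hasDerivAt_id t).smul_const c)
    rwa [h1 t ht, one_smul, sub_self] at this
  have h2 : EqOn (fun s : ℝ => F (p + s • v) - s • c)
      (fun _ => F (p + (T / 2) • v) - (T / 2) • c) (Ioo 0 T) := fun t ht =>
    isOpen_Ioo.is_const_of_deriv_eq_zero isPreconnected_Ioo
      (f := fun s : ℝ => F (p + s • v) - s • c)
      (fun s hs => (hg s hs).differentiableAt.differentiableWithinAt)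
      (fun s hs => (hg s hs).deriv) ht hm
  have hcont : ContinuousOn (fun s : ℝ => F (p + s • v) - s • c) (Icc 0 T) := by
    refine ContinuousOn.sub (h.continuousOn.comp (by fun_prop) hc) (by fun_prop)
  have h3 := h2.of_subset_closure hcont continuousOn_const Ioo_subset_Icc_self
    (closure_Ioo hT.ne).ge
  have e0 := h3 (left_mem_Icc.2 hT.le)
  have eT := h3 (right_mem_Icc.2 hT.le)
  simp only [zero_smul, add_zero, sub_zero] at e0 eT
  have : F (p + T • v) = F p + T • c := by rw [e0, ← eT]; abel
  rw [this, dist_self_add_right, norm_smul, hc_def, h.isometric _ (hi _ hm), Real.norm_eq_abs,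
    abs_of_pos hT]

theorem isBend_of_straight (h : IsDevelopingMap lam F) {a b : ℝ}
    (hv : ∀ y ∈ Ioo (0 : ℝ) 1, dir !₂[b - a, 1] (dir !₂[b - a, 1] F) (chord a b y) = 0) :
    IsBend F a b := by
  have e : ∀ t : ℝ, (!₂[a, 0] : Plane) + t • (!₂[b - a, 1] : Plane) = chord a b t := by
    intro t
    have := chord_add a b 0 t
    rw [zero_add] at this
    rw [← this]
    simp [chord]
  have := h.dist_eq_of_straight (p := !₂[a, 0]) (v := !₂[b - a, 1]) one_pos
    (fun t ht => by rw [e]; simpa [closedStrip] using ht)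
    (fun t ht => by rw [e]; exact chord_mem ht)
    (fun t ht => by rw [e]; exact hv t ht)
  have e1 : chord a b 1 = !₂[b, 1] := by simp [chord]
  rw [e, e1] at this
  rw [IsBend, this, one_mul, ← e1, ← e, one_smul, dist_self_add_right]

theorem periodic_two (h : IsDevelopingMap lam F) {p : Plane} (hp : p ∈ closedStrip) :
    F (p + (2 * lam) • (!₂[1, 0] : Plane)) = F p := by
  rw [← h.periodic p hp, ← h.periodic !₂[p 0 + lam, 1 - p 1]
    (by simpa [closedStrip, and_comm] using hp)]
  congr 1
  ext i
  fin_cases i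
  · simp; ring
  · simp

theorem periodic_neg (h : IsDevelopingMap lam F) {p : Plane} (hp : p ∈ closedStrip) :
    F !₂[p 0 + -lam, 1 - p 1] = F p := by
  rw [← h.periodic !₂[p 0 + -lam, 1 - p 1] (by simpa [closedStrip, and_comm] using hp)]
  congr 1
  ext i
  fin_cases i <;> simp

/-- The segment of length `2 * lam` would be mapped isometrically, but its two ends have the same
image. -/
theorem not_horizontal (h : IsDevelopingMap lam F) {p : Plane} (hp : p ∈ interiorStrip)
    (hv : ∀ t : ℝ, 0 ≤ t → dir !₂[1, 0] (dir !₂[1, 0] F) (p + t • !₂[1, 0]) = 0) : False := by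
  have hmem : ∀ t : ℝ, p + t • (!₂[1, 0] : Plane) ∈ interiorStrip := by
    intro t; simpa [interiorStrip] using hp
  have hl := h.pos
  have := h.dist_eq_of_straight (p := p) (v := !₂[1, 0]) (T := 2 * lam) (by positivity)
    (fun t _ => interiorStrip_subset (hmem t)) (fun t _ => hmem t)
    (fun t ht => hv t ht.1.le)
  rw [h.periodic_two (interiorStrip_subset hp), dist_self] at this
  simp [EuclideanSpace.norm_eq] at this
  exact hl.ne' this

/-- Otherwise all second derivatives vanish, and in particular a horizontal line is straight. -/
theorem exists_bent (h : IsDevelopingMap lam F) : ∃ p ∈ interiorStrip, Bent F p := by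
  by_contra! hcon
  have hp : (!₂[0, 1 / 2] : Plane) ∈ interiorStrip := by
    constructor <;> norm_num
  refine h.not_horizontal hp fun t _ => ?_
  by_contra hne
  refine hcon _ ?_ ⟨_, _, hne⟩
  constructor <;> norm_num

/-- The asymptotic direction at a bent point is not horizontal, so it can be scaled to `(τ, 1)`.
`bent_along_ruling`, applied upwards and downwards, reaches every interior height. -/
theorem exists_ruling (h : IsDevelopingMap lam F) {p : Plane} (hp : p ∈ interiorStrip)
    (hb : Bent F p) : ∃ a b, IsRuling F a b ∧ p = chord a b (p 1) := by
  have hU := isOpen_interiorStrip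
  obtain ⟨v, hv0, hv⟩ := exists_asymptotic_direction hU h.smooth h.isometric hp
  have hv1 : v 1 ≠ 0 := by
    intro h1
    have hv' : v = v 0 • (!₂[1, 0] : Plane) := by
      ext i; fin_cases i <;> simp [h1]
    have h0 : v 0 ≠ 0 := fun h0 => hv0 (by rw [hv', h0, zero_smul])
    have hz : dir !₂[1, 0] (dir !₂[1, 0] F) p = 0 := by
      rw [hv', dir_smul_left, dir_comm hU h.smooth hp, dir_smul_left] at hv
      simpa [h0] using hv
    refine h.not_horizontal hp fun t ht => ?_
    refine (bent_along_ruling hU h.smooth h.isometric (T := t) (fun s _ => ?_) hp hb hz t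
      ⟨ht, le_rfl⟩).2
    simpa [interiorStrip] using hp
  set τ := v 0 / v 1 with hτ
  have hv' : v = v 1 • (!₂[τ, 1] : Plane) := by
    ext i; fin_cases i
    · simp [hτ]; field_simp
    · simp
  have hz : dir !₂[τ, 1] (dir !₂[τ, 1] F) p = 0 := by
    rw [hv', dir_smul_left, dir_comm hU h.smooth hp, dir_smul_left] at hv
    simpa [hv1] using hv
  have hpc : p = chord (p 0 - p 1 * τ) (p 0 - p 1 * τ + τ) (p 1) := by
    ext i; fin_cases i
    · simp [chord]; ring
    · simp [chord]
  refine ⟨p 0 - p 1 * τ, p 0 - p 1 * τ + τ, ?_, hpc⟩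
  intro y hy
  have hadd : ∀ t : ℝ, p + t • (!₂[τ, 1] : Plane)
      = chord (p 0 - p 1 * τ) (p 0 - p 1 * τ + τ) (p 1 + t) := by
    intro t
    conv_lhs => rw [hpc]
    rw [← chord_add]
    simp
  have hτ' : p 0 - p 1 * τ + τ - (p 0 - p 1 * τ) = τ := by ring
  rw [hτ']
  rcases le_total (p 1) y with hle | hle
  · have := bent_along_ruling hU h.smooth h.isometric (T := y - p 1) (fun s hs => ?_) hp hb hz
      (y - p 1) ⟨by linarith, le_rfl⟩
    · rwa [hadd, add_sub_cancel] at this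
    · rw [hadd]
      exact chord_mem ⟨by linarith [hp.1, hs.1], by linarith [hy.2, hs.2]⟩
  · have neg : ∀ t : ℝ, t • (-(!₂[τ, 1] : Plane)) = (-t) • (!₂[τ, 1] : Plane) := by
      intro t; rw [smul_neg, neg_smul]
    have dneg : ∀ q ∈ interiorStrip,
        dir (-(!₂[τ, 1] : Plane)) (dir (-(!₂[τ, 1] : Plane)) F) q
          = dir !₂[τ, 1] (dir !₂[τ, 1] F) q := by
      intro q hq
      have : -(!₂[τ, 1] : Plane) = (-1 : ℝ) • (!₂[τ, 1] : Plane) := by rw [neg_smul, one_smul]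
      rw [this, dir_smul_left, dir_comm hU h.smooth hq, dir_smul_left]
      simp
    have hmem : ∀ s ∈ Icc 0 (p 1 - y), p + s • (-(!₂[τ, 1] : Plane)) ∈ interiorStrip := by
      intro s hs
      rw [neg, hadd]
      exact chord_mem ⟨by linarith [hy.1, hs.2], by linarith [hp.2, hs.1]⟩
    have := bent_along_ruling hU h.smooth h.isometric (T := p 1 - y) hmem hp hb
      (by rw [dneg p hp, hz]) (p 1 - y) ⟨by linarith, le_rfl⟩
    rw [dneg _ (hmem _ ⟨by linarith, le_rfl⟩), neg, hadd] at this
    rwa [show p 1 + -(p 1 - y) = y by ring] at this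

theorem ruling_unique (h : IsDevelopingMap lam F) {a b a' b' y : ℝ} (hy : y ∈ Ioo (0 : ℝ) 1)
    (hr : IsRuling F a b) (hr' : IsRuling F a' b')
    (he : (1 - y) * a + y * b = (1 - y) * a' + y * b') : a = a' ∧ b = b' := by
  have hd : b - a = b' - a' := by
    by_contra hne
    have hc : chord a b y = chord a' b' y := by simp [chord, he]
    refine not_bent_of_two_directions isOpen_interiorStrip h.smooth h.isometric
      (chord_mem hy) hne (hr y hy).2 ?_ (hr y hy).1
    rw [hc]
    exact (hr' y hy).2
  constructor
  · linear_combination he - y * hd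
  · linear_combination he + (1 - y) * hd

/-- If `a < a'` but `b > b'`, the two chords meet at the interior height `(a' - a) / ((a' - a) + (b
- b'))`, against `ruling_unique`. -/
theorem ruling_comparable (h : IsDevelopingMap lam F) {a b a' b' : ℝ}
    (hr : IsRuling F a b) (hr' : IsRuling F a' b') : (a ≤ a' ∧ b ≤ b') ∨ (a' ≤ a ∧ b' ≤ b) := by
  have key : ∀ {a b a' b' : ℝ}, IsRuling F a b → IsRuling F a' b' → a < a' → b ≤ b' := by
    intro a b a' b' hr hr' ha
    by_contra! hb
    have hpos : 0 < (a' - a) + (b - b') := by linarith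
    have := h.ruling_unique (y := (a' - a) / ((a' - a) + (b - b')))
      ⟨by apply div_pos <;> linarith, by rw [div_lt_one hpos]; linarith⟩ hr hr'
      (by field_simp; ring)
    linarith [this.1]
  rcases lt_trichotomy a a' with ha | ha | ha
  · exact Or.inl ⟨ha.le, key hr hr' ha⟩
  · rcases le_total b b' with hb | hb
    · exact Or.inl ⟨ha.le, hb⟩
    · exact Or.inr ⟨ha.ge, hb⟩
  · exact Or.inr ⟨ha.le, key hr' hr ha⟩

end IsDevelopingMap

/-- The chain rule for a glide reflection, whose linear part is `(x, y) ↦ (x, -y)`. It is stated for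
a pair of functions so that it can be applied again to first derivatives. -/
theorem dir_glide {f k : Plane → Space} {mu : ℝ}
    (hfk : ∀ p ∈ interiorStrip, f !₂[p 0 + mu, 1 - p 1] = k p) {p : Plane}
    (hp : p ∈ interiorStrip) (hf : DifferentiableAt ℝ f !₂[p 0 + mu, 1 - p 1])
    (hk : DifferentiableAt ℝ k p) (v : Plane) :
    dir !₂[v 0, -v 1] f !₂[p 0 + mu, 1 - p 1] = dir v k p := by
  have h1 := hasDerivAt_line (f := f) (p := !₂[p 0 + mu, 1 - p 1]) (v := !₂[v 0, -v 1]) (t := 0)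
    (by simpa using hf)
  have h2 := hasDerivAt_line (f := k) (p := p) (v := v) (t := 0) (by simpa using hk)
  simp only [zero_smul, add_zero] at h1 h2
  refine h1.unique (h2.congr_of_eventuallyEq ?_)
  have hc : Continuous fun t : ℝ => p + t • v := by fun_prop
  filter_upwards [hc.continuousAt.preimage_mem_nhds
    (isOpen_interiorStrip.mem_nhds (by simpa using hp : p + (0 : ℝ) • v ∈ interiorStrip))] with t ht
  rw [← hfk _ ht]
  congr 1
  ext i
  fin_cases i
  · simp; ring
  · simp; ring

theorem isRuling_glide {F : Plane → Space} (hF : ContDiffOn ℝ ∞ F interiorStrip) {mu : ℝ}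
    (hper : ∀ p ∈ interiorStrip, F !₂[p 0 + mu, 1 - p 1] = F p) {a b : ℝ} (hr : IsRuling F a b) :
    IsRuling F (b + mu) (a + mu) := by
  have hU := isOpen_interiorStrip
  have hmem : ∀ p ∈ interiorStrip, (!₂[p 0 + mu, 1 - p 1] : Plane) ∈ interiorStrip := by
    intro p hp
    simpa [interiorStrip, and_comm] using hp
  have d1 : ∀ v : Plane, ∀ p ∈ interiorStrip,
      dir !₂[v 0, -v 1] F !₂[p 0 + mu, 1 - p 1] = dir v F p := fun v p hp =>
    dir_glide hper hp (differentiableAt_of_smooth hU hF (hmem p hp))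
      (differentiableAt_of_smooth hU hF hp) v
  have d2 : ∀ v w : Plane, ∀ p ∈ interiorStrip,
      dir !₂[v 0, -v 1] (dir !₂[w 0, -w 1] F) !₂[p 0 + mu, 1 - p 1] = dir v (dir w F) p :=
    fun v w p hp => dir_glide (d1 w) hp
      (differentiableAt_of_smooth hU (contDiffOn_dir hU hF _) (hmem p hp))
      (differentiableAt_of_smooth hU (contDiffOn_dir hU hF _) hp) v
  intro y hy
  have hy' : 1 - y ∈ Ioo (0 : ℝ) 1 := ⟨by linarith [hy.2], by linarith [hy.1]⟩
  obtain ⟨⟨v, w, hvw⟩, hz⟩ := hr (1 - y) hy'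
  have hq : chord (b + mu) (a + mu) y
      = !₂[chord a b (1 - y) 0 + mu, 1 - chord a b (1 - y) 1] := by
    ext i
    fin_cases i
    · simp [chord]; ring
    · simp [chord]
  have hv : (!₂[a + mu - (b + mu), 1] : Plane) = (-1 : ℝ) •
      (!₂[(!₂[b - a, 1] : Plane) 0, -(!₂[b - a, 1] : Plane) 1] : Plane) := by
    ext i
    fin_cases i <;> simp
  rw [hq]
  constructor
  · refine ⟨!₂[v 0, -v 1], !₂[w 0, -w 1], ?_⟩
    rw [d2 v w _ (chord_mem hy')]
    exact hvw
  · rw [hv, dir_smul_left, dir_comm hU hF (hmem _ (chord_mem hy')), dir_smul_left,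
      d2 _ _ _ (chord_mem hy'), hz]
    simp

/-! ### Closed equivariant chains in the plane and their monotone completion -/

section Chains

variable {C : Set (ℝ × ℝ)}

/-- `d` lies on the segment between two elements of `C` that bound a gap of `C`. -/
def Interpolates (C : Set (ℝ × ℝ)) (d : ℝ × ℝ) : Prop :=
  ∃ c₁ ∈ C, ∃ c₂ ∈ C, c₁ ≤ c₂ ∧
    (∀ c ∈ C, ¬ (c₁.1 + c₁.2 < c.1 + c.2 ∧ c.1 + c.2 < c₂.1 + c₂.2)) ∧
    ∃ r ∈ Icc (0 : ℝ) 1, d = c₁ + r • (c₂ - c₁)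

theorem eq_of_le_of_sum_le {c d : ℝ × ℝ} (h : c ≤ d) (hs : d.1 + d.2 ≤ c.1 + c.2) : c = d :=
  Prod.ext (by linarith [h.1, h.2]) (by linarith [h.1, h.2])

/-- The coordinate sum is strictly increasing along the product order, so it serves as a parameter
on a chain. -/
theorem le_of_sum_le (hchain : ∀ c ∈ C, ∀ d ∈ C, c ≤ d ∨ d ≤ c) {c d : ℝ × ℝ} (hc : c ∈ C)
    (hd : d ∈ C) (hs : c.1 + c.2 ≤ d.1 + d.2) : c ≤ d := by
  rcases hchain c hc d hd with h | h
  · exact h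
  · exact (eq_of_le_of_sum_le h hs).ge

/-- The members above a fixed `c₀` with sum at most `s` form a compact set; those below `c₀` have
sums no larger than that of `c₀` and do not matter. -/
theorem exists_max_below (hcl : IsClosed C) (hchain : ∀ c ∈ C, ∀ d ∈ C, c ≤ d ∨ d ≤ c) {s : ℝ}
    (hne : ∃ c ∈ C, c.1 + c.2 ≤ s) :
    ∃ c ∈ C, c.1 + c.2 ≤ s ∧ ∀ d ∈ C, d.1 + d.2 ≤ s → d.1 + d.2 ≤ c.1 + c.2 := by
  obtain ⟨c₀, hc₀, hs₀⟩ := hne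
  set K : Set (ℝ × ℝ) := C ∩ {c | c.1 + c.2 ≤ s} ∩ Ici c₀ with hK
  have hKc : IsCompact K := by
    refine IsCompact.of_isClosed_subset
      (isCompact_Icc (a := c₀) (b := (c₀.1 + (s - c₀.1 - c₀.2), c₀.2 + (s - c₀.1 - c₀.2)))) ?_ ?_
    · exact (hcl.inter (isClosed_le (by fun_prop) continuous_const)).inter isClosed_Ici
    · rintro c ⟨⟨-, hs⟩, hc⟩
      have h1 := (mem_Ici.1 hc).1
      have h2 := (mem_Ici.1 hc).2
      have hs' : c.1 + c.2 ≤ s := hs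
      exact ⟨hc, by constructor <;> simp only <;> linarith⟩
  obtain ⟨c, hc, hmax⟩ := hKc.exists_isMaxOn ⟨c₀, ⟨hc₀, hs₀⟩, mem_Ici.2 le_rfl⟩
    (f := fun c : ℝ × ℝ => c.1 + c.2) (by fun_prop)
  refine ⟨c, hc.1.1, hc.1.2, fun d hd hds => ?_⟩
  rcases hchain c₀ hc₀ d hd with h | h
  · exact hmax (show d ∈ K from ⟨⟨hd, hds⟩, h⟩)
  · have := h.1
    have := h.2
    have := (mem_Ici.1 hc.2).1
    have := (mem_Ici.1 hc.2).2
    linarith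

theorem exists_min_above (hcl : IsClosed C) (hchain : ∀ c ∈ C, ∀ d ∈ C, c ≤ d ∨ d ≤ c) {s : ℝ}
    (hne : ∃ c ∈ C, s ≤ c.1 + c.2) :
    ∃ c ∈ C, s ≤ c.1 + c.2 ∧ ∀ d ∈ C, s ≤ d.1 + d.2 → c.1 + c.2 ≤ d.1 + d.2 := by
  obtain ⟨c₀, hc₀, hs₀⟩ := hne
  obtain ⟨c, hc, hcs, hmax⟩ := exists_max_below (C := -C) (s := -s) hcl.neg
    (fun c hc d hd => by
      rcases hchain _ hc _ hd with h | h
      · exact Or.inr (neg_le_neg_iff.1 h)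
      · exact Or.inl (neg_le_neg_iff.1 h))
    ⟨-c₀, by simpa using hc₀, by simp only [Prod.fst_neg, Prod.snd_neg]; linarith⟩
  refine ⟨-c, hc, by simp only [Prod.fst_neg, Prod.snd_neg]; linarith, fun d hd hds => ?_⟩
  have := hmax (-d) (by simpa using hd) (by simp only [Prod.fst_neg, Prod.snd_neg]; linarith)
  simp only [Prod.fst_neg, Prod.snd_neg] at this ⊢
  linarith

/-- Either the two gaps follow one another and their endpoints compare, or they overlap. As no
element of `C` lies inside a gap, overlapping gaps coincide, and the interpolation parameters `r`
and `r'` are compared. -/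
theorem Interpolates.le_of_sum_le (hchain : ∀ c ∈ C, ∀ d ∈ C, c ≤ d ∨ d ≤ c) {d d' : ℝ × ℝ}
    (h : Interpolates C d) (h' : Interpolates C d') (hs : d.1 + d.2 ≤ d'.1 + d'.2) : d ≤ d' := by
  obtain ⟨c₁, hc₁, c₂, hc₂, hle, hgap, r, hr, rfl⟩ := h
  obtain ⟨c₁', hc₁', c₂', hc₂', hle', hgap', r', hr', rfl⟩ := h'
  have b1 := mul_nonneg hr.1 (sub_nonneg.2 hle.1)
  have b2 := mul_nonneg hr.1 (sub_nonneg.2 hle.2)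
  have b3 := mul_nonneg (sub_nonneg.2 hr.2) (sub_nonneg.2 hle.1)
  have b4 := mul_nonneg (sub_nonneg.2 hr.2) (sub_nonneg.2 hle.2)
  have b1' := mul_nonneg hr'.1 (sub_nonneg.2 hle'.1)
  have b2' := mul_nonneg hr'.1 (sub_nonneg.2 hle'.2)
  have b3' := mul_nonneg (sub_nonneg.2 hr'.2) (sub_nonneg.2 hle'.1)
  have b4' := mul_nonneg (sub_nonneg.2 hr'.2) (sub_nonneg.2 hle'.2)
  simp only [Prod.fst_add, Prod.snd_add, Prod.smul_fst, Prod.smul_snd, Prod.fst_sub, Prod.snd_sub,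
    smul_eq_mul] at hs
  rw [Prod.le_def]
  simp only [Prod.fst_add, Prod.snd_add, Prod.smul_fst, Prod.smul_snd, Prod.fst_sub, Prod.snd_sub,
    smul_eq_mul]
  by_cases hA : c₂.1 + c₂.2 ≤ c₁'.1 + c₁'.2
  · have := PaperMoebius.le_of_sum_le hchain hc₂ hc₁' hA
    have h1 := this.1
    have h2 := this.2
    constructor <;> linarith
  push Not at hA
  by_cases hB : c₂'.1 + c₂'.2 ≤ c₁.1 + c₁.2
  · have := PaperMoebius.le_of_sum_le hchain hc₂' hc₁ hB
    have h1 := this.1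
    have h2 := this.2
    constructor <;> linarith
  push Not at hB
  have g1 := hgap c₁' hc₁'
  have g2 := hgap c₂' hc₂'
  have g1' := hgap' c₁ hc₁
  have g2' := hgap' c₂ hc₂
  have e1 : c₁ = c₁' := eq_of_le_of_sum_le
    (PaperMoebius.le_of_sum_le hchain hc₁ hc₁' (by
      by_contra! hlt; exact g1' ⟨hlt, hB⟩))
    (by by_contra! hlt; exact g1 ⟨hlt, hA⟩)
  subst e1
  have e2 : c₂ = c₂' := eq_of_le_of_sum_le
    (PaperMoebius.le_of_sum_le hchain hc₂ hc₂' (by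
      by_contra! hlt; exact g2 ⟨hB, hlt⟩))
    (by by_contra! hlt; exact g2' ⟨hA, hlt⟩)
  subst e2
  have hrr : r ≤ r' := by
    by_contra! hlt
    have : 0 < (r - r') * ((c₂.1 + c₂.2) - (c₁.1 + c₁.2)) :=
      mul_pos (by linarith) (by linarith)
    linarith
  have m1 := mul_le_mul_of_nonneg_right hrr (sub_nonneg.2 hle.1)
  have m2 := mul_le_mul_of_nonneg_right hrr (sub_nonneg.2 hle.2)
  constructor <;> linarith

theorem Interpolates.glide {lam : ℝ}
    (hg : ∀ c ∈ C, (c.2 + lam, c.1 + lam) ∈ C) (hg' : ∀ c ∈ C, (c.2 - lam, c.1 - lam) ∈ C)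
    {d : ℝ × ℝ} (h : Interpolates C d) : Interpolates C (d.2 + lam, d.1 + lam) := by
  obtain ⟨c₁, hc₁, c₂, hc₂, hle, hgap, r, hr, rfl⟩ := h
  refine ⟨_, hg c₁ hc₁, _, hg c₂ hc₂, ⟨?_, ?_⟩, ?_, r, hr, ?_⟩
  · simpa using hle.2
  · simpa using hle.1
  · rintro c hc ⟨h1, h2⟩
    refine hgap _ (hg' c hc) ⟨?_, ?_⟩ <;> simp only at h1 h2 ⊢ <;> linarith
  · ext <;> simp <;> ring

/-- A closed chain in `ℝ × ℝ` that is invariant under `(a, b) ↦ (b + lam, a + lam)`, with its gaps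
filled linearly, is an equivariant monotone curve. -/
theorem exists_equivariant_curve (hcl : IsClosed C) (hne : C.Nonempty)
    (hchain : ∀ c ∈ C, ∀ d ∈ C, c ≤ d ∨ d ≤ c) {lam : ℝ} (hlam : 0 < lam)
    (hg : ∀ c ∈ C, (c.2 + lam, c.1 + lam) ∈ C) (hg' : ∀ c ∈ C, (c.2 - lam, c.1 - lam) ∈ C) :
    ∃ a : ℝ → ℝ, Monotone a ∧ Monotone (fun s => s - a s) ∧
      (∀ s, a (s + 2 * lam) = s - a s + lam) ∧ ∀ s, Interpolates C (a s, s - a s) := by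
  obtain ⟨c₀, hc₀⟩ := hne
  -- Each glide shifts the sum by `2 * lam`, so `C` has elements of arbitrarily large and small sum:
  -- each `s` has a neighbour in `C` on either side.
  have hup : ∀ n : ℕ, ∃ c ∈ C, c.1 + c.2 = c₀.1 + c₀.2 + n * (2 * lam) := by
    intro n
    induction n with
    | zero => exact ⟨c₀, hc₀, by simp⟩
    | succ n ih =>
      obtain ⟨c, hc, hs⟩ := ih
      exact ⟨_, hg c hc, by push_cast; linarith⟩
  have hdown : ∀ n : ℕ, ∃ c ∈ C, c.1 + c.2 = c₀.1 + c₀.2 - n * (2 * lam) := by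
    intro n
    induction n with
    | zero => exact ⟨c₀, hc₀, by simp⟩
    | succ n ih =>
      obtain ⟨c, hc, hs⟩ := ih
      exact ⟨_, hg' c hc, by push_cast; linarith⟩
  have hex : ∀ s : ℝ, ∃ x : ℝ, Interpolates C (x, s - x) := by
    intro s
    obtain ⟨c₁, hc₁, hs₁, hmax⟩ := exists_max_below hcl hchain (s := s) (by
      obtain ⟨n, hn⟩ := exists_nat_gt ((c₀.1 + c₀.2 - s) / (2 * lam))
      obtain ⟨c, hc, hs⟩ := hdown n
      rw [div_lt_iff₀ (by positivity)] at hn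
      exact ⟨c, hc, by linarith⟩)
    obtain ⟨c₂, hc₂, hs₂, hmin⟩ := exists_min_above hcl hchain (s := s) (by
      obtain ⟨n, hn⟩ := exists_nat_gt ((s - (c₀.1 + c₀.2)) / (2 * lam))
      obtain ⟨c, hc, hs⟩ := hup n
      rw [div_lt_iff₀ (by positivity)] at hn
      exact ⟨c, hc, by linarith⟩)
    have hgap : ∀ c ∈ C, ¬ (c₁.1 + c₁.2 < c.1 + c.2 ∧ c.1 + c.2 < c₂.1 + c₂.2) := by
      rintro c hc ⟨h1, h2⟩
      rcases le_total (c.1 + c.2) s with h | h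
      · linarith [hmax c hc h]
      · linarith [hmin c hc h]
    have hle := le_of_sum_le hchain hc₁ hc₂ (hs₁.trans hs₂)
    rcases (hs₁.trans hs₂).eq_or_lt with heq | hlt
    · refine ⟨c₁.1, c₁, hc₁, c₂, hc₂, hle, hgap, 0, by simp, ?_⟩
      ext
      · simp
      · simp; linarith
    · have hpos : 0 < c₂.1 + c₂.2 - (c₁.1 + c₁.2) := by linarith
      set r := (s - (c₁.1 + c₁.2)) / (c₂.1 + c₂.2 - (c₁.1 + c₁.2)) with hr
      have hr' : r * (c₂.1 + c₂.2 - (c₁.1 + c₁.2)) = s - (c₁.1 + c₁.2) :=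
        div_mul_cancel₀ _ hpos.ne'
      refine ⟨c₁.1 + r * (c₂.1 - c₁.1), c₁, hc₁, c₂, hc₂, hle, hgap, r,
        ⟨div_nonneg (by linarith) hpos.le, by rw [hr, div_le_one hpos]; linarith⟩, ?_⟩
      ext
      · simp
      · simp; linarith
  choose a ha using hex
  have hmono : ∀ s t, s ≤ t → (a s, s - a s) ≤ (a t, t - a t) := fun s t hst =>
    (ha s).le_of_sum_le hchain (ha t) (by simpa using hst)
  refine ⟨a, fun s t hst => (hmono s t hst).1, fun s t hst => (hmono s t hst).2, fun s => ?_, ha⟩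
  -- The glide image of the point at `s` and the point at `s + 2 * lam` both interpolate and have
  -- equal sums, hence they are equal.
  have h1 := (ha s).glide hg hg'
  have h2 := ha (s + 2 * lam)
  have le1 := h1.le_of_sum_le hchain h2 (by simp only; linarith)
  have le2 := h2.le_of_sum_le hchain h1 (by simp only; linarith)
  exact le_antisymm le2.1 le1.1

end Chains

/-! ### The family of bends that sweeps out the strip -/

namespace IsDevelopingMap

variable {lam : ℝ} {F : Plane → Space}

/-- The pairs `(a, b)` that belong to rulings, and their limits. -/
def rulings (F : Plane → Space) : Set (ℝ × ℝ) := closure {c | IsRuling F c.1 c.2}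

theorem isBend_of_isRuling (h : IsDevelopingMap lam F) {a b : ℝ} (hr : IsRuling F a b) :
    IsBend F a b := h.isBend_of_straight fun y hy => (hr y hy).2

theorem continuous_bottom (h : IsDevelopingMap lam F) : Continuous fun a : ℝ => F !₂[a, 0] :=
  h.continuousOn.comp_continuous (by fun_prop) fun a => by simp [closedStrip]

theorem continuous_top (h : IsDevelopingMap lam F) : Continuous fun b : ℝ => F !₂[b, 1] :=
  h.continuousOn.comp_continuous (by fun_prop) fun a => by simp [closedStrip]

/-- A limit of rulings need not be bent, but being mapped isometrically onto a segment is an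
equality of continuous functions and passes to limits. -/
theorem isBend_of_mem_rulings (h : IsDevelopingMap lam F) {c : ℝ × ℝ} (hc : c ∈ rulings F) :
    IsBend F c.1 c.2 := by
  have hcl : IsClosed {c : ℝ × ℝ | IsBend F c.1 c.2} := by
    refine isClosed_eq ?_ ?_
    · exact (h.continuous_bottom.comp continuous_fst).dist (h.continuous_top.comp continuous_snd)
    · fun_prop
  exact closure_minimal (fun c hc => h.isBend_of_isRuling hc) hcl hc

theorem rulings_chain (h : IsDevelopingMap lam F) :
    ∀ c ∈ rulings F, ∀ d ∈ rulings F, c ≤ d ∨ d ≤ c := by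
  have hcl : IsClosed {x : (ℝ × ℝ) × (ℝ × ℝ) | x.1 ≤ x.2 ∨ x.2 ≤ x.1} :=
    (isClosed_le continuous_fst continuous_snd).union (isClosed_le continuous_snd continuous_fst)
  intro c hc d hd
  have : (c, d) ∈ closure ({c : ℝ × ℝ | IsRuling F c.1 c.2} ×ˢ {c : ℝ × ℝ | IsRuling F c.1 c.2}) := by
    rw [closure_prod_eq]; exact ⟨hc, hd⟩
  exact closure_minimal (fun x hx => h.ruling_comparable hx.1 hx.2) hcl this

theorem rulings_glide (h : IsDevelopingMap lam F) {mu : ℝ}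
    (hper : ∀ p ∈ closedStrip, F !₂[p 0 + mu, 1 - p 1] = F p) :
    ∀ c ∈ rulings F, (c.2 + mu, c.1 + mu) ∈ rulings F := by
  intro c hc
  exact map_mem_closure (f := fun c : ℝ × ℝ => (c.2 + mu, c.1 + mu)) (by fun_prop) hc
    fun d hd => isRuling_glide h.smooth (fun p hp => hper p (interiorStrip_subset hp)) hd

theorem rulings_nonempty (h : IsDevelopingMap lam F) : (rulings F).Nonempty := by
  obtain ⟨p, hp, hb⟩ := h.exists_bent
  obtain ⟨a, b, hr, -⟩ := h.exists_ruling hp hb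
  exact ⟨(a, b), subset_closure hr⟩

/-- Suppose that the second derivative along a chord strictly inside a gap is nonzero at some point.
A ruling then passes through that point; by comparability its sum lies strictly between the ends of
the gap, which is impossible. So the chord is straight. -/
theorem isBend_of_interpolates (h : IsDevelopingMap lam F) {d : ℝ × ℝ}
    (hd : Interpolates (rulings F) d) : IsBend F d.1 d.2 := by
  obtain ⟨c₁, hc₁, c₂, hc₂, hle, hgap, r, hr, rfl⟩ := hd
  by_cases htriv : r = 0 ∨ r = 1 ∨ c₁ = c₂
  · refine h.isBend_of_mem_rulings ?_
    rcases htriv with rfl | rfl | rfl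
    · simpa using hc₁
    · simpa using hc₂
    · simpa using hc₁
  push Not at htriv
  obtain ⟨hr0, hr1, hne⟩ := htriv
  have hr0' : 0 < r := lt_of_le_of_ne hr.1 (Ne.symm hr0)
  have hr1' : r < 1 := lt_of_le_of_ne hr.2 hr1
  have hlt : c₁.1 + c₁.2 < c₂.1 + c₂.2 := by
    by_contra! hge
    exact hne (eq_of_le_of_sum_le hle hge)
  refine h.isBend_of_straight fun y hy => ?_
  by_contra hbent
  obtain ⟨a, b, hab, hpt⟩ := h.exists_ruling (chord_mem hy) ⟨_, _, hbent⟩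
  have hc : (a, b) ∈ rulings F := subset_closure hab
  have hpt0 := congrArg (fun q : Plane => q 0) hpt
  simp only [chord_zero_coord, chord_one_coord, Prod.fst_add, Prod.snd_add, Prod.smul_fst,
    Prod.smul_snd, Prod.fst_sub, Prod.snd_sub, smul_eq_mul] at hpt0
  have hy0 := hy.1
  have hy1 : 0 < 1 - y := by linarith [hy.2]
  have hw : 0 < (1 - y) * (c₂.1 - c₁.1) + y * (c₂.2 - c₁.2) := by
    have h1 := hle.1
    have h2 := hle.2
    rcases h1.lt_or_eq with h1' | h1'
    · have := mul_pos hy1 (sub_pos.2 h1')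
      have := mul_nonneg hy0.le (sub_nonneg.2 h2)
      linarith
    · have := mul_pos hy0 (show 0 < c₂.2 - c₁.2 by linarith)
      rw [h1']
      linarith
  have hw1 := mul_pos hr0' hw
  have hw2 := mul_pos (sub_pos.2 hr1') hw
  have below : ∀ {c c' : ℝ × ℝ}, c ≤ c' →
      (1 - y) * c.1 + y * c.2 ≤ (1 - y) * c'.1 + y * c'.2 := fun h =>
    add_le_add (mul_le_mul_of_nonneg_left h.1 hy1.le) (mul_le_mul_of_nonneg_left h.2 hy0.le)
  have n1 : ¬ ((a, b) ≤ c₁) := fun hle' => by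
    have := below hle'
    simp only at this
    linarith
  have n2 : ¬ (c₂ ≤ (a, b)) := fun hle' => by
    have := below hle'
    simp only at this
    linarith
  refine hgap _ hc ⟨?_, ?_⟩
  · by_contra! hge
    exact n1 (le_of_sum_le h.rulings_chain hc hc₁ hge)
  · by_contra! hge
    exact n2 (le_of_sum_le h.rulings_chain hc₂ hc hge)

/-- The strip is swept out by an equivariant monotone family of bends. -/
theorem exists_bends (h : IsDevelopingMap lam F) :
    ∃ a : ℝ → ℝ, Monotone a ∧ Monotone (fun s => s - a s) ∧
      (∀ s, a (s + 2 * lam) = s - a s + lam) ∧ ∀ s, IsBend F (a s) (s - a s) := by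
  have hcl : IsClosed (rulings F) := isClosed_closure
  have hg := h.rulings_glide h.periodic
  have hg' : ∀ c ∈ rulings F, (c.2 - lam, c.1 - lam) ∈ rulings F := by
    intro c hc
    rw [sub_eq_add_neg, sub_eq_add_neg]
    exact h.rulings_glide (fun p hp => h.periodic_neg hp) c hc
  obtain ⟨a, h1, h2, h3, h4⟩ :=
    exists_equivariant_curve hcl h.rulings_nonempty h.rulings_chain h.pos hg hg'
  refine ⟨a, h1, h2, h3, fun s => ?_⟩
  have := h.isBend_of_interpolates (h4 s)
  simpa only using this

end IsDevelopingMap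

/-! ### Orthogonal coplanar bends and the triangle that they produce -/

/-- `F` is injective up to the glide reflections. -/
def IsEmbedded (lam : ℝ) (F : Plane → Space) : Prop :=
  ∀ p ∈ closedStrip, ∀ q ∈ closedStrip, F p = F q →
    ∃ k : ℤ, q 0 = p 0 + k * lam ∧ q 1 = if Even k then p 1 else 1 - p 1

/-- A pair of continuous functions on the triangle `0 ≤ x ≤ y ≤ L` that lies on the positive axis
along the diagonal and is antisymmetric on the legs vanishes somewhere. -/
theorem exists_common_zero {f g : ℝ → ℝ → ℝ} (hf : Continuous fun z : ℝ × ℝ => f z.1 z.2)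
    (hg : Continuous fun z : ℝ × ℝ => g z.1 z.2) {L : ℝ} (hL : 0 ≤ L)
    (hfd : ∀ x, 0 < f x x) (hgd : ∀ x, g x x = 0)
    (hfa : ∀ y, f y L = - f 0 y) (hga : ∀ y, g y L = - g 0 y) :
    ∃ x y, 0 ≤ x ∧ x ≤ y ∧ y ≤ L ∧ f x y = 0 ∧ g x y = 0 := by
  by_contra! hcon
  -- `(rx, ry)` retracts the plane onto the triangle, so that `H = f + i g` is defined on a simply
  -- connected space and has a continuous logarithm `θ`.
  set ry : ℝ × ℝ → ℝ := fun z => max 0 (min L z.2) with hry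
  set rx : ℝ × ℝ → ℝ := fun z => max 0 (min (ry z) z.1) with hrx
  have cry : Continuous ry := by fun_prop
  have crx : Continuous rx := by fun_prop
  set H : C(ℝ × ℝ, ℂ) := ⟨fun z => (f (rx z) (ry z) : ℂ) + (g (rx z) (ry z) : ℂ) * Complex.I, by
    have h1 := hf.comp (crx.prodMk cry)
    have h2 := hg.comp (crx.prodMk cry)
    exact (Complex.continuous_ofReal.comp h1).add
      ((Complex.continuous_ofReal.comp h2).mul continuous_const)⟩ with hH
  have hHne : ∀ z, H z ∈ ({0}ᶜ : Set ℂ) := by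
    intro z hz
    have hz' : (f (rx z) (ry z) : ℂ) + (g (rx z) (ry z) : ℂ) * Complex.I = 0 := hz
    have hre := congrArg Complex.re hz'
    have him := congrArg Complex.im hz'
    simp at hre him
    have hy0 : 0 ≤ ry z := le_max_left _ _
    exact hcon (rx z) (ry z) (le_max_left _ _) (max_le hy0 (min_le_left _ _))
      (max_le hL (min_le_left _ _)) hre him
  obtain ⟨θ, ⟨-, hθ⟩, -⟩ := Complex.isCoveringMapOn_exp.existsUnique_continuousMap_lifts H
    (a₀ := (0, 0)) (e₀ := Complex.log (H (0, 0))) (Complex.exp_log (hHne _)) hHne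
  have hexp : ∀ z, Complex.exp (θ z) = H z := fun z => congrFun hθ z
  have hconst : ∀ k : ℝ → ℂ, Continuous k → ∀ c, (∀ t, Complex.exp (k t) = c) → k 0 = k L := by
    intro k hk c hc
    exact Complex.isCoveringMap_exp.const_of_comp hk
      (fun s t => Subtype.ext (by simp only; rw [hc, hc])) 0 L
  have hdiag : ∀ x, H (x, x) = (f (ry (x, x)) (ry (x, x)) : ℂ) := by
    intro x
    have : rx (x, x) = ry (x, x) := by
      simp only [hrx, hry]
      rcases le_total 0 x with h | h
      · rw [max_eq_right (le_min hL h), min_eq_left (min_le_right _ _),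
          max_eq_right (le_min hL h)]
      · have : min L x ≤ 0 := (min_le_right _ _).trans h
        rw [max_eq_left this, min_eq_right h, max_eq_left h]
    show (f (rx (x, x)) (ry (x, x)) : ℂ) + (g (rx (x, x)) (ry (x, x)) : ℂ) * Complex.I = _
    rw [this, hgd]
    simp
  have r0 : ry (0, 0) = 0 := by simp [hry, hL]
  have rL : ry (L, L) = L := by simp [hry, hL]
  -- On the diagonal `H` is a positive real, so `θ` differs from the real logarithm by a constant;
  -- and `f L L = f 0 0` by two uses of the antisymmetry.
  have e1 : θ (0, 0) = θ (L, L) := by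
    have cf : Continuous fun x : ℝ => f (ry (x, x)) (ry (x, x)) :=
      hf.comp ((cry.comp (by fun_prop)).prodMk (cry.comp (by fun_prop)))
    have := hconst (fun x => θ (x, x) - (Real.log (f (ry (x, x)) (ry (x, x))) : ℂ))
      ((θ.continuous.comp (by fun_prop)).sub
        (Complex.continuous_ofReal.comp (cf.log fun x => (hfd _).ne'))) 1 (by
        intro t
        rw [Complex.exp_sub, hexp, hdiag, ← Complex.ofReal_exp, Real.exp_log (hfd _), div_self]
        exact_mod_cast (hfd _).ne')
    simp only [r0, rL] at this
    have hLL : f L L = f 0 0 := by rw [hfa L, hfa 0, neg_neg]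
    rw [hLL] at this
    exact sub_left_injective this
  have hneg : ∀ t, H (t, L) = - H (0, t) := by
    intro t
    have y1 : ry (t, L) = L := by simp [hry, hL]
    have x1 : rx (t, L) = ry (0, t) := by
      show max 0 (min (ry (t, L)) t) = _
      rw [y1]
    have x2 : rx (0, t) = 0 := by
      simp only [hrx]
      rw [min_eq_right (le_max_left _ _), max_self]
    show (f (rx (t, L)) (ry (t, L)) : ℂ) + (g (rx (t, L)) (ry (t, L)) : ℂ) * Complex.I
      = -((f (rx (0, t)) (ry (0, t)) : ℂ) + (g (rx (0, t)) (ry (0, t)) : ℂ) * Complex.I)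
    rw [y1, x1, x2, hfa, hga]
    push_cast
    ring
  have hm1 : ∀ t, Complex.exp (θ (t, L) - θ (0, t)) = -1 := by
    intro t
    rw [Complex.exp_sub, hexp, hexp, hneg, neg_div, div_self (hHne _)]
  -- The difference `θ (t, L) - θ (0, t)` is constant. By `e1` its values at `t = 0` and `t = L` are
  -- opposite, so it is `0`; yet its exponential is `-1`.
  have e2 := hconst (fun t => θ (t, L) - θ (0, t))
    ((θ.continuous.comp (by fun_prop)).sub (θ.continuous.comp (by fun_prop))) (-1) hm1
  have h3 : θ (0, L) - θ (0, 0) = 0 := by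
    rw [← e1] at e2
    linear_combination (1 / 2) * e2
  have h4 := hm1 0
  rw [h3, Complex.exp_zero] at h4
  norm_num at h4

/-- The determinant of three vectors of `ℝ³`. -/
def triple (u v w : Space) : ℝ :=
  u 0 * (v 1 * w 2 - v 2 * w 1) - u 1 * (v 0 * w 2 - v 2 * w 0) + u 2 * (v 0 * w 1 - v 1 * w 0)

theorem inner_eq_sum (u v : Space) : inner ℝ u v = u 0 * v 0 + u 1 * v 1 + u 2 * v 2 := by
  simp [PiLp.inner_apply, Fin.sum_univ_three, mul_comm]

/-- A vector that is coplanar with two orthogonal vectors is a combination of them. -/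
theorem exists_coeffs_of_triple_eq_zero {z u v : Space} (hu : u ≠ 0) (hv : v ≠ 0)
    (huv : inner ℝ u v = 0) (ht : triple z u v = 0) : ∃ α β : ℝ, z = α • u + β • v := by
  have hu' : inner ℝ u u ≠ 0 := by simpa using hu
  have hv' : inner ℝ v v ≠ 0 := by simpa using hv
  refine ⟨inner ℝ z u / inner ℝ u u, inner ℝ z v / inner ℝ v v, ?_⟩
  set α := inner ℝ z u / inner ℝ u u with hα
  set β := inner ℝ z v / inner ℝ v v with hβ
  set y := z - (α • u + β • v) with hy
  have hyu : inner ℝ y u = 0 := by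
    rw [hy, inner_sub_left, inner_add_left, real_inner_smul_left, real_inner_smul_left,
      real_inner_comm u v, huv, hα, div_mul_cancel₀ _ hu']
    ring
  have hyv : inner ℝ y v = 0 := by
    rw [hy, inner_sub_left, inner_add_left, real_inner_smul_left, real_inner_smul_left, huv, hβ,
      div_mul_cancel₀ _ hv']
    ring
  have hyt : triple y u v = 0 := by
    have : triple y u v = triple z u v := by
      simp only [triple, hy, PiLp.sub_apply, PiLp.add_apply, PiLp.smul_apply, smul_eq_mul]
      ring
    rw [this, ht]
  -- The square of a determinant is the Gram determinant. The residual `y` is orthogonal to `u` and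
  -- `v`, which leaves `‖y‖² ‖u‖² ‖v‖² = 0`.
  have gram : triple y u v ^ 2 = inner ℝ y y * (inner ℝ u u * inner ℝ v v - inner ℝ u v ^ 2)
      - inner ℝ y u * (inner ℝ y u * inner ℝ v v - inner ℝ u v * inner ℝ y v)
      + inner ℝ y v * (inner ℝ y u * inner ℝ u v - inner ℝ u u * inner ℝ y v) := by
    simp only [triple, inner_eq_sum]
    ring
  rw [hyt, hyu, hyv, huv] at gram
  have h0 : inner ℝ y y * (inner ℝ u u * inner ℝ v v) = 0 := by linear_combination -gram
  have : inner ℝ y y = 0 := by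
    rcases mul_eq_zero.1 h0 with h | h
    · exact h
    · exact absurd h (mul_ne_zero hu' hv')
  exact sub_eq_zero.1 (inner_self_eq_zero.1 this)

namespace IsDevelopingMap

variable {lam : ℝ} {F : Plane → Space}

/-- The Lipschitz bounds on the two pieces add up to the exact distance of the ends, so the triangle
inequality is an equality; in a strictly convex space this places the image on the segment. -/
theorem apply_chord_of_isBend (h : IsDevelopingMap lam F) {a b r : ℝ} (hb : IsBend F a b)
    (hr : r ∈ Icc (0 : ℝ) 1) :
    F (chord a b r) = F !₂[a, 0] + r • (F !₂[b, 1] - F !₂[a, 0]) := by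
  have e0 : (!₂[a, 0] : Plane) = chord a b 0 := by simp [chord]
  have e1 : (!₂[b, 1] : Plane) = chord a b 1 := by simp [chord]
  have hd : ∀ s t : ℝ, dist (chord a b s) (chord a b t) = |t - s| * ‖(!₂[b - a, 1] : Plane)‖ := by
    intro s t
    have := chord_add a b s (t - s)
    rw [add_sub_cancel] at this
    rw [← this, dist_self_add_right, norm_smul, Real.norm_eq_abs]
  have mem : ∀ t ∈ Icc (0 : ℝ) 1, chord a b t ∈ closedStrip := fun t ht => by
    simpa [closedStrip] using ht
  have m0 := mem 0 (by simp)
  have m1 := mem 1 (by simp)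
  have mr := mem r hr
  have l1 := h.lipschitz _ m0 _ mr
  have l2 := h.lipschitz _ mr _ m1
  rw [IsBend, e0, e1] at hb
  rw [hd] at hb l1 l2
  rw [sub_zero, abs_of_nonneg hr.1] at l1
  rw [abs_of_nonneg (sub_nonneg.2 hr.2)] at l2
  simp only [sub_zero, abs_one, one_mul] at hb
  have tri := dist_triangle (F (chord a b 0)) (F (chord a b r)) (F (chord a b 1))
  have := eq_lineMap_of_dist_eq_mul_of_dist_eq_mul (x := F (chord a b 0)) (y := F (chord a b r))
    (z := F (chord a b 1)) (r := r) (by rw [hb]; linarith) (by rw [hb]; linarith)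
  rw [e0, e1, this, AffineMap.lineMap_apply, vsub_eq_sub, vadd_eq_add, add_comm]

/-- Bends at distinct parameters modulo the glide reflection do not cross. -/
theorem bends_disjoint (h : IsDevelopingMap lam F) (hemb : IsEmbedded lam F) {a : ℝ → ℝ}
    (ha : Monotone a) (hb : Monotone fun s => s - a s)
    (hg : ∀ s, a (s + 2 * lam) = s - a s + lam) (hbend : ∀ s, IsBend F (a s) (s - a s))
    {x y r r' : ℝ} (hxy : x < y) (hyx : y < x + 2 * lam) (hr : r ∈ Ioo (0 : ℝ) 1)
    (hr' : r' ∈ Ioo (0 : ℝ) 1)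
    (he : F !₂[a x, 0] + r • (F !₂[x - a x, 1] - F !₂[a x, 0])
      = F !₂[a y, 0] + r' • (F !₂[y - a y, 1] - F !₂[a y, 0])) : False := by
  have hl := h.pos
  rw [← h.apply_chord_of_isBend (hbend x) (Ioo_subset_Icc_self hr),
    ← h.apply_chord_of_isBend (hbend y) (Ioo_subset_Icc_self hr')] at he
  obtain ⟨k, hk0, hk1⟩ := hemb _ (interiorStrip_subset (chord_mem hr)) _
    (interiorStrip_subset (chord_mem hr')) he
  simp only [chord_zero_coord, chord_one_coord] at hk0 hk1
  -- At a fixed interior height the family of bends moves strictly to the right, because both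
  -- endpoints are nondecreasing and their sum is `s`.
  have key : ∀ s t ρ : ℝ, ρ ∈ Ioo (0 : ℝ) 1 →
      (1 - ρ) * a s + ρ * (s - a s) = (1 - ρ) * a t + ρ * (t - a t) → s = t := by
    have : ∀ s t ρ : ℝ, ρ ∈ Ioo (0 : ℝ) 1 →
      (1 - ρ) * a s + ρ * (s - a s) = (1 - ρ) * a t + ρ * (t - a t) → ¬ s < t := by
      intro s t ρ hρ heq hlt
      have h1 := ha hlt.le
      have h2 : s - a s ≤ t - a t := hb hlt.le
      have h3 := mul_nonneg (sub_nonneg.2 hρ.2.le) (sub_nonneg.2 h1)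
      have h4 := mul_nonneg hρ.1.le (sub_nonneg.2 h2)
      have h5 : (1 - ρ) * (a t - a s) = 0 := by linarith
      have h6 : ρ * ((t - a t) - (s - a s)) = 0 := by linarith
      have h7 : a t - a s = 0 :=
        (mul_eq_zero.1 h5).resolve_left (by linarith [hρ.2])
      have h8 : (t - a t) - (s - a s) = 0 :=
        (mul_eq_zero.1 h6).resolve_left hρ.1.ne'
      linarith
    intro s t ρ hρ heq
    rcases lt_trichotomy s t with hlt | hlt | hlt
    · exact absurd hlt (this s t ρ hρ heq)
    · exact hlt
    · exact absurd hlt (this t s ρ hρ heq.symm)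
  have h4 : ∀ s, a (s + 4 * lam) = a s + 2 * lam := by
    intro s
    have := hg (s + 2 * lam)
    rw [hg s] at this
    rw [show s + 4 * lam = s + 2 * lam + 2 * lam by ring, this]
    ring
  have hper : ∀ (m : ℤ) (s : ℝ), a (s + m * (4 * lam)) = a s + m * (2 * lam) := by
    intro m
    induction m with
    | zero => simp
    | succ n ih =>
      intro s
      have := ih (s + 4 * lam)
      rw [h4] at this
      rw [show s + ((n + 1 : ℤ) : ℝ) * (4 * lam) = s + 4 * lam + ((n : ℤ) : ℝ) * (4 * lam) by
        push_cast; ring, this]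
      push_cast
      ring
    | pred n ih =>
      intro s
      have := ih (s - 4 * lam)
      have h5 := h4 (s - 4 * lam)
      rw [sub_add_cancel] at h5
      rw [show s + ((-(n : ℤ) - 1 : ℤ) : ℝ) * (4 * lam)
        = s - 4 * lam + ((-(n : ℤ) : ℤ) : ℝ) * (4 * lam) by push_cast; ring, this, h5]
      push_cast
      ring
  -- The `k`-th power of the glide moves the bend at `x` to the bend at `x + 2 * lam * k`. An odd
  -- `k` exchanges the ends, whence the height `1 - r`. Then `0 < y - x < 2 * lam` leaves no integer
  -- `k`.
  have hshift : y = x + k * (2 * lam) := by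
    rcases Int.even_or_odd k with hk | hk
    · rw [if_pos hk] at hk1
      subst hk1
      obtain ⟨m, rfl⟩ := hk
      have hp := hper m x
      refine key y _ r' hr' ?_
      rw [show x + ((m + m : ℤ) : ℝ) * (2 * lam) = x + m * (4 * lam) by push_cast; ring, hp, hk0]
      push_cast
      ring
    · rw [if_neg (Int.not_even_iff_odd.2 hk)] at hk1
      subst hk1
      obtain ⟨m, rfl⟩ := hk
      have hp := hper m (x + 2 * lam)
      rw [hg] at hp
      refine key y _ (1 - r) hr' ?_
      rw [show x + ((2 * m + 1 : ℤ) : ℝ) * (2 * lam) = x + 2 * lam + m * (4 * lam) by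
        push_cast; ring, hp, hk0]
      push_cast
      ring
  have k0 : (0 : ℝ) < k := by
    by_contra! hk
    nlinarith
  have k1 : (k : ℝ) < 1 := by
    by_contra! hk
    nlinarith
  have k0' : 0 < k := by exact_mod_cast k0
  have k1' : k < 1 := by exact_mod_cast k1
  omega

/-- The configuration that a T-pattern produces: a bend from `(a, 0)` to `(b, 1)` and a point
`(c, 0)` between `(a, 0)` and `(b + lam, 0)` whose image is at distance at least `1` from the line
of the bend. -/
theorem exists_triangle (h : IsDevelopingMap lam F) (hemb : IsEmbedded lam F) :
    ∃ a b c : ℝ, a ≤ c ∧ c ≤ b + lam ∧ b ≤ a + lam ∧ IsBend F a b ∧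
      ∃ e : Space, ‖e‖ = 1 ∧ inner ℝ (F !₂[b, 1] - F !₂[a, 0]) e = 0 ∧
        1 ≤ inner ℝ (F !₂[c, 0] - F !₂[a, 0]) e := by
  have hl := h.pos
  obtain ⟨a, ha, hb, hg, hbend⟩ := h.exists_bends
  -- `a s` and `s - a s` are both nondecreasing and add up to `s`, so each is `1`-Lipschitz.
  have hacont : Continuous a := by
    refine (LipschitzWith.of_dist_le_mul (K := 1) fun s t => ?_).continuous
    rw [NNReal.coe_one, one_mul, Real.dist_eq, Real.dist_eq]
    rcases le_total s t with hst | hst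
    · have h1 := ha hst
      have h2 : s - a s ≤ t - a t := hb hst
      rw [abs_of_nonpos (by linarith), abs_of_nonpos (by linarith)]
      linarith
    · have h1 := ha hst
      have h2 : t - a t ≤ s - a s := hb hst
      rw [abs_of_nonneg (by linarith), abs_of_nonneg (by linarith)]
      linarith
  -- Since `(b, 1)` is glued to `(b + lam, 0)`, the upper end of the bend at `s` is the lower end of
  -- the bend at `s + 2 * lam`. One loop `φ` of period `4 * lam` thus carries both ends of every
  -- bend.
  set φ : ℝ → Space := fun s => F !₂[a s, 0] with hφ
  have hφc : Continuous φ := h.continuous_bottom.comp hacont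
  have hφL : ∀ s, φ (s + 2 * lam) = F !₂[s - a s, 1] := by
    intro s
    have := h.periodic !₂[s - a s, 1] (by simp [closedStrip])
    simp only [hφ, hg]
    rw [← this]
    simp
  have hφ2 : ∀ s, φ (s + 2 * lam + 2 * lam) = φ s := by
    intro s
    have h1 := h.periodic !₂[a s, 0] (by simp [closedStrip])
    have h2 := hg s
    rw [hφL, h2]
    simp only [hφ]
    rw [← h1]
    simp only [Matrix.cons_val_zero, Matrix.cons_val_one, sub_zero]
    congr 3
    ring
  set D : ℝ → Space := fun s => φ (s + 2 * lam) - φ s with hD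
  have hDc : Continuous D := (hφc.comp (by fun_prop)).sub hφc
  have hDL : ∀ s, D (s + 2 * lam) = - D s := by
    intro s
    simp only [hD, hφ2]
    abel
  have hDnorm : ∀ s, 1 ≤ ‖D s‖ := by
    intro s
    have h1 : ‖D s‖ = dist (!₂[a s, 0] : Plane) !₂[s - a s, 1] := by
      rw [← hbend s, dist_comm, dist_eq_norm, ← hφL]
    rw [h1, EuclideanSpace.dist_eq]
    apply Real.le_sqrt_of_sq_le
    simp [Real.dist_eq]
    positivity
  have hD0 : ∀ s, D s ≠ 0 := fun s hs => by
    have := hDnorm s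
    rw [hs, norm_zero] at this
    linarith
  have apex1 : ∀ s z : ℝ, s ≤ z → z ≤ s + 2 * lam → ∀ e : Space, ‖e‖ = 1 → inner ℝ (D s) e = 0 →
      1 ≤ inner ℝ (φ z - φ s) e → ∃ a b c : ℝ, a ≤ c ∧ c ≤ b + lam ∧ b ≤ a + lam ∧ IsBend F a b ∧
      ∃ e : Space, ‖e‖ = 1 ∧ inner ℝ (F !₂[b, 1] - F !₂[a, 0]) e = 0 ∧
        1 ≤ inner ℝ (F !₂[c, 0] - F !₂[a, 0]) e := by
    intro s z hsz hzs e he1 he2 he3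
    have h1 := ha hzs
    have h2 : s - a s ≤ s + 2 * lam - a (s + 2 * lam) := hb (by linarith)
    rw [hg] at h1 h2
    refine ⟨a s, s - a s, a z, ha hsz, h1, by linarith, hbend s, e, he1, ?_, he3⟩
    rw [← hφL]
    exact he2
  -- Beyond `s + 2 * lam` the same segment is used with its ends exchanged, as the bend at `s + 2 *
  -- lam`.
  have apex : ∀ s z : ℝ, s ≤ z → z ≤ s + 4 * lam → ∀ e : Space, ‖e‖ = 1 → inner ℝ (D s) e = 0 →
      1 ≤ inner ℝ (φ z - φ s) e → ∃ a b c : ℝ, a ≤ c ∧ c ≤ b + lam ∧ b ≤ a + lam ∧ IsBend F a b ∧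
      ∃ e : Space, ‖e‖ = 1 ∧ inner ℝ (F !₂[b, 1] - F !₂[a, 0]) e = 0 ∧
        1 ≤ inner ℝ (F !₂[c, 0] - F !₂[a, 0]) e := by
    intro s z hsz hzs e he1 he2 he3
    rcases le_total z (s + 2 * lam) with hz | hz
    · exact apex1 s z hsz hz e he1 he2 he3
    · refine apex1 (s + 2 * lam) z hz (by linarith) e he1 ?_ ?_
      · rw [hDL, inner_neg_left, he2, neg_zero]
      · have : φ z - φ (s + 2 * lam) = (φ z - φ s) - D s := by simp only [hD]; abel
        rw [this, inner_sub_left, he2, sub_zero]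
        exact he3
  -- `f` measures orthogonality and `g` coplanarity. The latter uses doubled midpoints, which are
  -- invariant under the exchange of ends, so that only the sign of `D` enters the antisymmetry on
  -- the legs.
  obtain ⟨x, y, hx0, hxy, hyL, hfz, hgz⟩ := exists_common_zero
    (f := fun x y => inner ℝ (D x) (D y))
    (g := fun x y => triple (φ x + φ (x + 2 * lam) - (φ y + φ (y + 2 * lam))) (D x) (D y))
    (L := 2 * lam) (by fun_prop)
    (by
      have c1 : ∀ i, Continuous fun s => φ s i := fun i => by fun_prop
      have c2 : ∀ i, Continuous fun s => D s i := fun i => by fun_prop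
      simp only [triple, PiLp.sub_apply, PiLp.add_apply]
      fun_prop)
    (by positivity)
    (fun x => by rw [real_inner_self_eq_norm_sq]; have := hDnorm x; positivity)
    (fun x => by simp [triple])
    (fun y => by
      have := hDL 0
      rw [zero_add] at this
      rw [this, inner_neg_right, real_inner_comm])
    (fun y => by
      have h1 := hDL 0
      have h2 := hφ2 0
      rw [zero_add] at h1 h2
      simp only [h1, h2, zero_add, triple, PiLp.sub_apply, PiLp.add_apply, PiLp.neg_apply]
      ring)
  have hne1 : x ≠ y := by
    rintro rfl
    exact hD0 x (inner_self_eq_zero.1 hfz)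
  have hxy' : x < y := lt_of_le_of_ne hxy hne1
  have hyx : y < x + 2 * lam := by
    by_contra! hge
    have e1 : x = 0 := by linarith
    have e2 : y = 0 + 2 * lam := by linarith
    rw [e1, e2, hDL, inner_neg_right, neg_eq_zero] at hfz
    exact hD0 0 (inner_self_eq_zero.1 hfz)
  obtain ⟨α, β, hαβ⟩ := exists_coeffs_of_triple_eq_zero (hD0 x) (hD0 y) hfz hgz
  -- Solving the midpoint relation for the intersection of the two lines: `r` and `r'` are its
  -- affine coordinates on the bends at `x` and `y`.
  set r := (1 - α) / 2 with hr
  set r' := (1 + β) / 2 with hr'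
  have hz : φ x + r • D x = φ y + r' • D y := by
    have e1 : φ x + φ (x + 2 * lam) = (2 : ℝ) • φ x + D x := by
      simp only [hD, two_smul]; abel
    have e2 : φ y + φ (y + 2 * lam) = (2 : ℝ) • φ y + D y := by
      simp only [hD, two_smul]; abel
    rw [e1, e2] at hαβ
    have e3 : (2 : ℝ) • φ x = (2 : ℝ) • φ y + D y - D x + (α • D x + β • D y) := by
      rw [← hαβ]; abel
    have e4 : φ x = (1 / 2 : ℝ) • ((2 : ℝ) • φ x) := by rw [smul_smul]; norm_num
    rw [e4, e3, hr, hr']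
    module
  have hunit : ∀ s, ‖(‖D s‖⁻¹ • D s : Space)‖ = 1 := fun s => norm_smul_inv_norm (𝕜 := ℝ) (hD0 s)
  have hself : ∀ s, inner ℝ (D s) (‖D s‖⁻¹ • D s) = ‖D s‖ := by
    intro s
    rw [real_inner_smul_right, real_inner_self_eq_norm_sq, sq, ← mul_assoc,
      inv_mul_cancel₀ (norm_ne_zero_iff.2 (hD0 s)), one_mul]
  have hcross : inner ℝ (D x) (‖D y‖⁻¹ • D y) = 0 := by
    rw [real_inner_smul_right, hfz, mul_zero]
  have hcross' : inner ℝ (D y) (‖D x‖⁻¹ • D x) = 0 := by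
    rw [real_inner_smul_right, real_inner_comm, hfz, mul_zero]
  -- If the intersection is not interior to one bend, the far end of that bend has distance at least
  -- `‖D‖ ≥ 1` from the line of the other. The four cases say which bend and which end; in the last,
  -- `φ x` is written `φ (x + 4 * lam)` so that it comes after `y`.
  by_cases c1 : r' ≤ 0
  · refine apex x (y + 2 * lam) (by linarith) (by linarith) (‖D y‖⁻¹ • D y) (hunit y) hcross ?_
    have : φ (y + 2 * lam) - φ x = r • D x + (1 - r') • D y := by
      have e : φ (y + 2 * lam) = φ y + D y := by simp only [hD]; abel
      have e' : φ x = φ y + r' • D y - r • D x := by rw [← hz]; abel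
      rw [e, e']
      module
    rw [this, inner_add_left, real_inner_smul_left, real_inner_smul_left, hcross, hself]
    nlinarith [hDnorm y]
  by_cases c2 : 1 ≤ r'
  · refine apex x y hxy (by linarith) (-(‖D y‖⁻¹ • D y)) (by rw [norm_neg]; exact hunit y)
      (by rw [inner_neg_right, hcross, neg_zero]) ?_
    have : φ y - φ x = r • D x + (-r') • D y := by
      have e' : φ x = φ y + r' • D y - r • D x := by rw [← hz]; abel
      rw [e']
      module
    rw [this, inner_neg_right, inner_add_left, real_inner_smul_left, real_inner_smul_left, hcross,
      hself]
    nlinarith [hDnorm y]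
  by_cases c3 : r ≤ 0
  · refine apex y (x + 2 * lam) (by linarith) (by linarith) (‖D x‖⁻¹ • D x) (hunit x) hcross' ?_
    have : φ (x + 2 * lam) - φ y = r' • D y + (1 - r) • D x := by
      have e : φ (x + 2 * lam) = φ x + D x := by simp only [hD]; abel
      have e' : φ y = φ x + r • D x - r' • D y := by rw [hz]; abel
      rw [e, e']
      module
    rw [this, inner_add_left, real_inner_smul_left, real_inner_smul_left, hcross', hself]
    nlinarith [hDnorm x]
  by_cases c4 : 1 ≤ r
  · refine apex y (x + 2 * lam + 2 * lam) (by linarith) (by linarith) (-(‖D x‖⁻¹ • D x))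
      (by rw [norm_neg]; exact hunit x) (by rw [inner_neg_right, hcross', neg_zero]) ?_
    have : φ (x + 2 * lam + 2 * lam) - φ y = r' • D y + (-r) • D x := by
      have e' : φ y = φ x + r • D x - r' • D y := by rw [hz]; abel
      rw [hφ2, e']
      module
    rw [this, inner_neg_right, inner_add_left, real_inner_smul_left, real_inner_smul_left, hcross',
      hself]
    nlinarith [hDnorm x]
  push Not at c1 c2 c3 c4
  exfalso
  refine h.bends_disjoint hemb ha hb hg hbend hxy' hyx ⟨c3, c4⟩ ⟨c1, c2⟩ ?_
  simp only [hD, hφL] at hz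
  exact hz

end IsDevelopingMap

/-! ### From preservation of arc length to a developing map -/

theorem eVariationOn_le_of_lipschitz {E : Type*} [PseudoEMetricSpace E] {f : ℝ → E} {K : NNReal}
    {a b : ℝ} (hab : a ≤ b) (hf : LipschitzOnWith K f (Icc a b)) :
    eVariationOn f (Icc a b) ≤ K * ENNReal.ofReal (b - a) := by
  have h1 := hf.comp_eVariationOn_le (g := (id : ℝ → ℝ)) (mapsTo_id _)
  have h2 := (monotone_id.monotoneOn (Icc a b)).eVariationOn_eq
    (left_mem_Icc.2 hab) (right_mem_Icc.2 hab)
  rw [inter_self] at h2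
  rw [h2] at h1
  exact h1

/-- The segment that issues from `p` with velocity `v`, with its parameter clamped to `[0, T]`. -/
def segmentCurve (p v : Plane) (T : ℝ) (h : ∀ t ∈ Icc 0 T, p + t • v ∈ closedStrip) (hT : 0 ≤ T)
    (t : ℝ) : Strip :=
  ⟨p + (max 0 (min T t)) • v, h _ ⟨le_max_left _ _, max_le hT (min_le_left _ _)⟩⟩

theorem segmentCurve_apply {p v : Plane} {T : ℝ} (h : ∀ t ∈ Icc 0 T, p + t • v ∈ closedStrip)
    (hT : 0 ≤ T) {t : ℝ} (ht : t ∈ Icc 0 T) : (segmentCurve p v T h hT t).1 = p + t • v := by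
  simp only [segmentCurve]
  rw [min_eq_right ht.2, max_eq_right ht.1]

theorem continuous_segmentCurve {p v : Plane} {T : ℝ}
    (h : ∀ t ∈ Icc 0 T, p + t • v ∈ closedStrip) (hT : 0 ≤ T) :
    Continuous (segmentCurve p v T h hT) :=
  Continuous.subtype_mk (by fun_prop) _

theorem eVariationOn_segmentCurve_le {p v : Plane} {T : ℝ}
    (h : ∀ t ∈ Icc 0 T, p + t • v ∈ closedStrip) (hT : 0 ≤ T) :
    eVariationOn (segmentCurve p v T h hT) (Icc 0 T) ≤ ENNReal.ofReal (‖v‖ * T) := by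
  have hl : LipschitzOnWith ‖v‖₊ (segmentCurve p v T h hT) (Icc 0 T) := by
    refine LipschitzOnWith.of_dist_le_mul fun s hs t ht => ?_
    rw [Subtype.dist_eq, segmentCurve_apply h hT hs, segmentCurve_apply h hT ht,
      dist_add_left, dist_eq_norm, ← sub_smul, norm_smul, mul_comm, coe_nnnorm, dist_eq_norm]
  refine (eVariationOn_le_of_lipschitz hT hl).trans ?_
  rw [sub_zero, ENNReal.ofReal_mul (norm_nonneg _), ofReal_norm]
  rfl

theorem exists_glide_of_proj_eq {lam : ℝ} {p q : Strip} (h : proj lam p = proj lam q) :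
    ∃ k : ℤ, q.1 0 = p.1 0 + k * lam ∧ q.1 1 = if Even k then p.1 1 else 1 - p.1 1 := by
  have h' := Quot.eqvGen_exact h
  clear h
  induction h' with
  | rel p q hpq => exact ⟨1, by subst hpq; simp [glide, Strip.mk]⟩
  | refl p => exact ⟨0, by simp⟩
  | symm p q _ ih =>
    obtain ⟨k, h0, h1⟩ := ih
    refine ⟨-k, by rw [h0]; push_cast; ring, ?_⟩
    rw [h1]
    by_cases hk : Even k <;> simp [hk]
  | trans p q r _ _ ih ih' =>
    obtain ⟨k, h0, h1⟩ := ih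
    obtain ⟨l, h0', h1'⟩ := ih'
    refine ⟨k + l, by rw [h0', h0]; push_cast; ring, ?_⟩
    rw [h1', h1]
    by_cases hk : Even k <;> by_cases hl : Even l <;> simp [hk, hl, Int.even_add]

/-- The lift to the strip of a smooth embedded paper Moebius band. -/
theorem IsSmoothEmbeddedBand.exists_developingMap {lam : ℝ} {I : FlatMoebius lam → Space}
    (hI : IsSmoothEmbeddedBand lam I) :
    ∃ F : Plane → Space, IsDevelopingMap lam F ∧ IsEmbedded lam F ∧
      ∀ p : Strip, F p.1 = I (proj lam p) := by
  obtain ⟨ε, hε, F, hF, -, hFI⟩ := hI.smooth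
  have hvar : ∀ (γ : ℝ → Strip) (a b : ℝ), ContinuousOn γ (Icc a b) →
      eVariationOn (fun t => F (γ t).1) (Icc a b) = eVariationOn γ (Icc a b) := by
    intro γ a b hγ
    rw [← hI.isometric γ a b hγ]
    congr 1
    funext t
    exact hFI _
  have hsmooth : ContDiffOn ℝ ∞ F interiorStrip :=
    hF.mono fun p hp => ⟨by linarith [hp.1], by linarith [hp.2]⟩
  -- The strip is convex: the image of a straight segment is a curve of the same length, which
  -- bounds the distance of its ends.
  have hlip : ∀ p ∈ closedStrip, ∀ q ∈ closedStrip, dist (F p) (F q) ≤ dist p q := by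
    intro p hp q hq
    have hseg : ∀ t ∈ Icc (0 : ℝ) 1, p + t • (q - p) ∈ closedStrip := by
      intro t ht
      have e : (p + t • (q - p)) 1 = (1 - t) * p 1 + t * q 1 := by simp; ring
      have ht' := sub_nonneg.2 ht.2
      constructor
      · rw [e]
        exact add_nonneg (mul_nonneg ht' hp.1) (mul_nonneg ht.1 hq.1)
      · rw [e]
        nlinarith [mul_le_mul_of_nonneg_left hp.2 ht', mul_le_mul_of_nonneg_left hq.2 ht.1]
    have m0 : (0 : ℝ) ∈ Icc (0 : ℝ) 1 := by simp
    have m1 : (1 : ℝ) ∈ Icc (0 : ℝ) 1 := by simp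
    have h1 := eVariationOn.edist_le
      (fun t => F (segmentCurve p (q - p) 1 hseg zero_le_one t).1) m0 m1
    rw [hvar _ _ _ (continuous_segmentCurve hseg zero_le_one).continuousOn] at h1
    have h2 := h1.trans (eVariationOn_segmentCurve_le hseg zero_le_one)
    simp only [segmentCurve_apply hseg zero_le_one m0, segmentCurve_apply hseg zero_le_one m1] at h2
    simp only [zero_smul, add_zero, one_smul, add_sub_cancel, mul_one] at h2
    rw [edist_dist, ENNReal.ofReal_le_ofReal_iff (norm_nonneg _)] at h2
    rwa [dist_comm p q, dist_eq_norm q p]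
  refine ⟨F, ⟨hI.pos, hsmooth, hlip, ?_, ?_⟩, ?_, hFI⟩
  · intro p hp v
    have hcont : Continuous fun t : ℝ => p + t • v := by fun_prop
    have hev : ∀ᶠ t : ℝ in 𝓝 0, p + t • v ∈ interiorStrip :=
      hcont.continuousAt.preimage_mem_nhds
        (isOpen_interiorStrip.mem_nhds (by simpa using hp))
    have hd : ∀ t : ℝ, p + t • v ∈ interiorStrip →
        HasDerivAt (fun s : ℝ => F (p + s • v)) (dir v F (p + t • v)) t := fun t ht =>
      hasDerivAt_line (differentiableAt_of_smooth isOpen_interiorStrip hsmooth ht)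
    apply le_antisymm
    · have := hd 0 (by simpa using hp)
      simp only [zero_smul, add_zero] at this
      refine this.le_of_lip' (norm_nonneg v) ?_
      filter_upwards [hev] with t ht
      have h1 := hlip _ (interiorStrip_subset ht) _ (interiorStrip_subset hp)
      rw [dist_eq_norm, dist_eq_norm, add_sub_cancel_left, norm_smul] at h1
      simpa [mul_comm] using h1
    -- If `F` contracted the direction `v` at `p`, then by continuity it would be `r`-Lipschitz in
    -- `t`, with `r < ‖v‖`, along a short segment, and would shorten that curve.
    · by_contra! hlt
      obtain ⟨r, hr1, hr2⟩ := exists_between hlt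
      have hr0 : 0 ≤ r := (norm_nonneg _).trans hr1.le
      lift r to NNReal using hr0
      have hcd : ContinuousAt (fun t : ℝ => ‖dir v F (p + t • v)‖) 0 := by
        have hc1 : ContinuousAt (dir v F) (p + (0 : ℝ) • v) :=
          (differentiableAt_of_smooth isOpen_interiorStrip
            (contDiffOn_dir isOpen_interiorStrip hsmooth v) (by simpa using hp)).continuousAt
        exact (ContinuousAt.comp (f := fun t : ℝ => p + t • v) hc1 hcont.continuousAt).norm
      have hev2 : ∀ᶠ t : ℝ in 𝓝 0, ‖dir v F (p + t • v)‖ < r :=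
        hcd.eventually (gt_mem_nhds (by simpa using hr1))
      obtain ⟨δ, hδ, hball⟩ := Metric.eventually_nhds_iff.1 (hev.and hev2)
      set T := δ / 2 with hT_def
      have hT : 0 < T := by positivity
      have hin : ∀ t ∈ Icc 0 T, p + t • v ∈ interiorStrip ∧ ‖dir v F (p + t • v)‖ < r := by
        intro t ht
        apply hball
        rw [Real.dist_eq, sub_zero, abs_of_nonneg ht.1]
        linarith [ht.2]
      have hseg : ∀ t ∈ Icc 0 T, p + t • v ∈ closedStrip := fun t ht =>
        interiorStrip_subset (hin t ht).1
      have hl : LipschitzOnWith r (fun t => F (segmentCurve p v T hseg hT.le t).1)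
          (Icc 0 T) := by
        have : LipschitzOnWith r (fun t : ℝ => F (p + t • v)) (Icc 0 T) :=
          (convex_Icc 0 T).lipschitzOnWith_of_nnnorm_hasDerivWithin_le
            (fun t ht => (hd t (hin t ht).1).hasDerivWithinAt)
            (fun t ht => NNReal.coe_le_coe.1 (hin t ht).2.le)
        intro s hs t ht
        simp only [segmentCurve_apply hseg hT.le hs, segmentCurve_apply hseg hT.le ht]
        exact this hs ht
      have m0 : (0 : ℝ) ∈ Icc 0 T := ⟨le_rfl, hT.le⟩
      have m1 : T ∈ Icc 0 T := ⟨hT.le, le_rfl⟩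
      have h1 := eVariationOn.edist_le (segmentCurve p v T hseg hT.le) m0 m1
      rw [← hvar _ _ _ (continuous_segmentCurve hseg hT.le).continuousOn] at h1
      have h2 := h1.trans (eVariationOn_le_of_lipschitz hT.le hl)
      rw [edist_dist, Subtype.dist_eq, segmentCurve_apply hseg hT.le m0,
        segmentCurve_apply hseg hT.le m1, zero_smul, add_zero, dist_self_add_right, norm_smul,
        sub_zero, Real.norm_eq_abs, abs_of_pos hT] at h2
      have h3 : (r : ENNReal) * ENNReal.ofReal T = ENNReal.ofReal (r * T) := by
        rw [ENNReal.ofReal_mul r.coe_nonneg, ENNReal.ofReal_coe_nnreal]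
      rw [h3, ENNReal.ofReal_le_ofReal_iff (by positivity)] at h2
      nlinarith
  · intro p hp
    have h1 := hFI ⟨p, hp⟩
    have h2 := hFI (glide lam ⟨p, hp⟩)
    rw [show proj lam (glide lam ⟨p, hp⟩) = proj lam ⟨p, hp⟩ from
      (Quot.sound (r := fun p q : Strip => q = glide lam p) rfl).symm, ← h1] at h2
    exact h2
  · intro p hp q hq he
    refine exists_glide_of_proj_eq (p := ⟨p, hp⟩) (q := ⟨q, hq⟩) (hI.embedded ?_)
    rw [← hFI, ← hFI]
    exact he

/-! ### The limiting shape of the triangle -/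

/-- In a triangle whose base `w + w'` is orthogonal to the unit vector `e` and whose height is at
least `1`, the sides `w` and `w'` satisfy a reflection inequality. -/
theorem sq_norm_sub_norm_le {V : Type*} [NormedAddCommGroup V] [InnerProductSpace ℝ V]
    {w w' e : V} (he : ‖e‖ = 1) (hb : inner ℝ (w + w') e = 0) (hw : 1 ≤ inner ℝ w e) :
    (‖w‖ - ‖w'‖) ^ 2 ≤ ‖w‖ * ‖w'‖ * ((‖w‖ + ‖w'‖) ^ 2 - ‖w + w'‖ ^ 2 - 4) := by
  set k := inner ℝ w e with hk
  have hw' : inner ℝ w' e = -k := by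
    rw [inner_add_left] at hb
    linarith
  have hee : inner ℝ e e = (1 : ℝ) := by rw [real_inner_self_eq_norm_sq, he, one_pow]
  -- `u` is `w'` reflected in the plane orthogonal to `e`, so `‖u‖ = ‖w'‖` and `u` has the same
  -- height `k` as `w`. Cauchy–Schwarz against `e` bounds the failure of `w` and `u` to be parallel
  -- from below by the difference of their norms.
  set u := w' + (2 * k) • e with hu
  have hue : inner ℝ u e = k := by
    rw [hu, inner_add_left, real_inner_smul_left, hw', hee]; ring
  have hun : ‖u‖ = ‖w'‖ := by
    have : ‖u‖ ^ 2 = ‖w'‖ ^ 2 := by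
      rw [hu, norm_add_sq_real, real_inner_smul_right, hw', norm_smul, he, mul_one,
        Real.norm_eq_abs, sq_abs]
      ring
    exact (pow_left_inj₀ (norm_nonneg _) (norm_nonneg _) two_ne_zero).1 this
  have hwu : 2 * inner ℝ w u = ‖w + w'‖ ^ 2 - ‖w‖ ^ 2 - ‖w'‖ ^ 2 + 4 * k ^ 2 := by
    rw [hu, inner_add_right, real_inner_smul_right, ← hk, norm_add_sq_real]; ring
  have hz : ‖‖u‖ • w - ‖w‖ • u‖ ^ 2 = 2 * (‖w‖ * ‖u‖) * (‖w‖ * ‖u‖ - inner ℝ w u) := by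
    rw [norm_sub_sq_real, real_inner_smul_left, real_inner_smul_right, norm_smul, norm_smul,
      norm_norm, norm_norm]
    ring
  have hz' : inner ℝ (‖u‖ • w - ‖w‖ • u) e = k * (‖u‖ - ‖w‖) := by
    rw [inner_sub_left, real_inner_smul_left, real_inner_smul_left, hue, ← hk]; ring
  have hcs : (k * (‖u‖ - ‖w‖)) ^ 2 ≤ ‖‖u‖ • w - ‖w‖ • u‖ ^ 2 := by
    rw [← hz', ← sq_abs]
    refine pow_le_pow_left₀ (abs_nonneg _) ?_ 2
    simpa [he] using abs_real_inner_le_norm (‖u‖ • w - ‖w‖ • u) e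
  rw [hz, hun] at hcs
  have hk2 : 1 ≤ k ^ 2 := one_le_pow₀ hw
  have h0 : 0 ≤ ‖w‖ * ‖w'‖ := by positivity
  have h1 : (‖w‖ - ‖w'‖) ^ 2 ≤ (k * (‖w'‖ - ‖w‖)) ^ 2 := by
    rw [mul_pow]
    nlinarith [sq_nonneg (‖w'‖ - ‖w‖)]
  have h2 : 2 * (‖w‖ * ‖w'‖) * (‖w‖ * ‖w'‖ - inner ℝ w u)
      ≤ ‖w‖ * ‖w'‖ * ((‖w‖ + ‖w'‖) ^ 2 - ‖w + w'‖ ^ 2 - 4) := by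
    have : 2 * (‖w‖ * ‖w'‖ - inner ℝ w u) ≤ (‖w‖ + ‖w'‖) ^ 2 - ‖w + w'‖ ^ 2 - 4 := by
      nlinarith
    nlinarith [mul_le_mul_of_nonneg_left this h0]
  linarith

/-- The boundary arcs and the height bound squeeze `t` between two functions of `lam` with common
limit `1 / √3`. Then `d₀ + d₁`, caught between `√(l² + 4)` and `lam + t`, tends to `4 / √3`; the
last factor in `hrefl` tends to `0` and forces `d₀ - d₁ → 0`. -/
theorem tendsto_triangle_shape {lam t l d₀ d₁ : ℕ → ℝ} (hlam : Tendsto lam atTop (𝓝 (√3)))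
    (hpos : ∀ n, 0 < lam n) (hl0 : ∀ n, 0 ≤ l n) (hd₀ : ∀ n, 1 ≤ d₀ n) (hd₁ : ∀ n, 1 ≤ d₁ n)
    (hl : ∀ n, l n ^ 2 = 1 + t n ^ 2) (hle : ∀ n, l n ≤ lam n - t n)
    (hsum : ∀ n, d₀ n + d₁ n ≤ lam n + t n)
    (hrefl : ∀ n, (d₀ n - d₁ n) ^ 2 ≤ d₀ n * d₁ n * ((d₀ n + d₁ n) ^ 2 - l n ^ 2 - 4)) :
    Tendsto t atTop (𝓝 (1 / √3)) ∧ Tendsto l atTop (𝓝 (2 / √3)) ∧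
      Tendsto d₀ atTop (𝓝 (2 / √3)) ∧ Tendsto d₁ atTop (𝓝 (2 / √3)) := by
  have h3 : (√3 : ℝ) ^ 2 = 3 := Real.sq_sqrt (by norm_num)
  have h3p : (0 : ℝ) < √3 := by positivity
  have hS : ∀ n, l n ^ 2 + 4 ≤ (d₀ n + d₁ n) ^ 2 := by
    intro n
    by_contra! hlt
    have h1 : 0 < d₀ n * d₁ n := mul_pos (by linarith [hd₀ n]) (by linarith [hd₁ n])
    have h2 := mul_pos h1 (show 0 < -((d₀ n + d₁ n) ^ 2 - l n ^ 2 - 4) by linarith)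
    nlinarith [hrefl n, sq_nonneg (d₀ n - d₁ n)]
  have hup : ∀ n, (d₀ n + d₁ n) ^ 2 ≤ (lam n + t n) ^ 2 := fun n =>
    pow_le_pow_left₀ (by linarith [hd₀ n, hd₁ n]) (hsum n) 2
  have hlup : ∀ n, l n ^ 2 ≤ (lam n - t n) ^ 2 := fun n => pow_le_pow_left₀ (hl0 n) (hle n) 2
  have ht : Tendsto t atTop (𝓝 (1 / √3)) := by
    refine tendsto_of_tendsto_of_tendsto_of_le_of_le
      (g := fun n => (5 - lam n ^ 2) / (2 * lam n)) (h := fun n => (lam n ^ 2 - 1) / (2 * lam n))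
      ?_ ?_ ?_ ?_
    · have h : Tendsto (fun n => (5 - lam n ^ 2) / (2 * lam n)) atTop
          (𝓝 ((5 - √3 ^ 2) / (2 * √3))) :=
        (tendsto_const_nhds.sub (hlam.pow 2)).div (hlam.const_mul 2) (by positivity)
      rwa [show (5 - √3 ^ 2) / (2 * √3) = 1 / √3 by rw [h3]; field_simp; norm_num] at h
    · have h : Tendsto (fun n => (lam n ^ 2 - 1) / (2 * lam n)) atTop
          (𝓝 ((√3 ^ 2 - 1) / (2 * √3))) :=
        ((hlam.pow 2).sub tendsto_const_nhds).div (hlam.const_mul 2) (by positivity)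
      rwa [show (√3 ^ 2 - 1) / (2 * √3) = 1 / √3 by rw [h3]; field_simp; norm_num] at h
    · intro n
      have := hpos n
      simp only
      rw [div_le_iff₀ (by positivity)]
      nlinarith [hS n, hup n, hl n]
    · intro n
      have := hpos n
      simp only
      rw [le_div_iff₀ (by positivity)]
      nlinarith [hlup n, hl n]
  have hsq : ∀ {f : ℕ → ℝ} {c : ℝ}, (∀ n, 0 ≤ f n) → 0 ≤ c →
      Tendsto (fun n => f n ^ 2) atTop (𝓝 (c ^ 2)) → Tendsto f atTop (𝓝 c) := by
    intro f c hf hc h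
    have := h.sqrt
    simpa only [Real.sqrt_sq hc, Real.sqrt_sq (hf _)] using this
  have e2 : (1 / √3) ^ 2 = (1 / 3 : ℝ) := by rw [div_pow, h3]; norm_num
  have e3 : (2 / √3) ^ 2 = (4 / 3 : ℝ) := by rw [div_pow, h3]; norm_num
  have e4 : (4 / √3) ^ 2 = (16 / 3 : ℝ) := by rw [div_pow, h3]; norm_num
  have e5 : √3 + 1 / √3 = 4 / √3 := by field_simp; rw [h3]; norm_num
  have hl2 : Tendsto (fun n => l n ^ 2) atTop (𝓝 ((2 / √3) ^ 2)) := by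
    simp only [hl]
    have := (ht.pow 2).const_add 1
    rw [e2] at this
    rw [e3]
    convert this using 2
    norm_num
  have hlim := hsq hl0 (by positivity) hl2
  have hup' : Tendsto (fun n => (lam n + t n) ^ 2) atTop (𝓝 ((4 / √3) ^ 2)) := by
    rw [← e5]; exact (hlam.add ht).pow 2
  have hs : Tendsto (fun n => d₀ n + d₁ n) atTop (𝓝 (4 / √3)) := by
    refine hsq (fun n => by linarith [hd₀ n, hd₁ n]) (by positivity) ?_
    refine tendsto_of_tendsto_of_tendsto_of_le_of_le (g := fun n => l n ^ 2 + 4) ?_ hup'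
      (fun n => hS n) (fun n => hup n)
    have := hl2.add_const 4
    rw [e3] at this
    rw [e4]
    convert this using 2
    norm_num
  have hdiff : Tendsto (fun n => d₀ n - d₁ n) atTop (𝓝 0) := by
    have hbound : ∀ n, (d₀ n - d₁ n) ^ 2
        ≤ (d₀ n + d₁ n) ^ 2 * ((d₀ n + d₁ n) ^ 2 - l n ^ 2 - 4) := by
      intro n
      refine (hrefl n).trans (mul_le_mul_of_nonneg_right ?_ (by linarith [hS n]))
      nlinarith [hd₀ n, hd₁ n, sq_nonneg (d₀ n), sq_nonneg (d₁ n),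
        mul_nonneg (zero_le_one.trans (hd₀ n)) (zero_le_one.trans (hd₁ n))]
    have hz : Tendsto (fun n => (d₀ n - d₁ n) ^ 2) atTop (𝓝 0) := by
      refine squeeze_zero (fun n => sq_nonneg _) hbound ?_
      have := (hs.pow 2).mul (((hs.pow 2).sub hl2).sub_const 4)
      rw [e3, e4] at this
      convert this using 2
      norm_num
    have := hz.sqrt
    simp only [Real.sqrt_sq_eq_abs, Real.sqrt_zero] at this
    exact (tendsto_zero_iff_abs_tendsto_zero _).2 this
  refine ⟨ht, hlim, ?_, ?_⟩
  · have := (hs.add hdiff).div_const 2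
    convert this using 2 <;> ring
  · have := (hs.sub hdiff).div_const 2
    convert this using 2 <;> ring

/-! ### Moving the triangle into standard position -/

/-- Any nondegenerate triangle can be moved into the plane of the first two coordinates. -/
theorem exists_isometry_triangle (A : Space) {P₀ P₁ P₂ : Space} {r d α : ℝ}
    (hr : dist P₀ P₁ = r) (hd : dist P₀ P₂ = d) (hr0 : 0 < r)
    (hα : 2 * r * α = r ^ 2 + d ^ 2 - dist P₁ P₂ ^ 2) (hdeg : α ^ 2 < d ^ 2) :
    ∃ Φ : Space ≃ᵢ Space, Φ P₀ = A ∧ Φ P₁ = A + !₂[r, 0, 0] ∧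
      Φ P₂ = A + !₂[α, √(d ^ 2 - α ^ 2), 0] := by
  set w₁ := P₁ - P₀ with hw₁
  set w₂ := P₂ - P₀ with hw₂
  have n1 : ‖w₁‖ = r := by rw [hw₁, ← dist_eq_norm, dist_comm, hr]
  have n2 : ‖w₂‖ = d := by rw [hw₂, ← dist_eq_norm, dist_comm, hd]
  have n12 : ‖w₁ - w₂‖ = dist P₁ P₂ := by rw [dist_eq_norm, hw₁, hw₂]; congr 1; abel
  have hin : inner ℝ w₁ w₂ = r * α := by
    have := norm_sub_sq_real w₁ w₂
    rw [n1, n2, n12] at this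
    linarith
  set e₀ := r⁻¹ • w₁ with he₀
  have hw₁e : w₁ = r • e₀ := by rw [he₀, smul_smul, mul_inv_cancel₀ hr0.ne', one_smul]
  have n0 : ‖e₀‖ = 1 := by
    rw [he₀, norm_smul, n1, norm_inv, Real.norm_eq_abs, abs_of_pos hr0, inv_mul_cancel₀ hr0.ne']
  have hin0 : inner ℝ e₀ w₂ = α := by
    rw [he₀, real_inner_smul_left, hin, ← mul_assoc, inv_mul_cancel₀ hr0.ne', one_mul]
  set β := √(d ^ 2 - α ^ 2) with hβ
  have hβ0 : 0 < β := Real.sqrt_pos.2 (by linarith)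
  set y := w₂ - α • e₀ with hy
  have ny : ‖y‖ = β := by
    rw [hβ, ← Real.sqrt_sq (norm_nonneg y)]
    congr 1
    rw [hy, norm_sub_sq_real, real_inner_smul_right, real_inner_comm, hin0, norm_smul, n0, n2,
      mul_one, Real.norm_eq_abs, sq_abs]
    ring
  have hy0 : inner ℝ e₀ y = 0 := by
    rw [hy, inner_sub_right, hin0, real_inner_smul_right, real_inner_self_eq_norm_sq, n0]
    ring
  set e₁ := β⁻¹ • y with he₁
  have hye : y = β • e₁ := by rw [he₁, smul_smul, mul_inv_cancel₀ hβ0.ne', one_smul]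
  have n1' : ‖e₁‖ = 1 := by
    rw [he₁, norm_smul, ny, norm_inv, Real.norm_eq_abs, abs_of_pos hβ0, inv_mul_cancel₀ hβ0.ne']
  have h01 : inner ℝ e₀ e₁ = 0 := by rw [he₁, real_inner_smul_right, hy0, mul_zero]
  obtain ⟨b, hb⟩ := Orthonormal.exists_orthonormalBasis_extension_of_card_eq (𝕜 := ℝ) (E := Space)
    (ι := Fin 3) (by simp) (v := ![e₀, e₁, 0]) (s := {0, 1}) (by
      constructor
      · rintro ⟨i, hi⟩
        rcases hi with rfl | rfl
        · simpa using n0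
        · simpa using n1'
      · rintro ⟨i, hi⟩ ⟨j, hj⟩ hij
        rcases hi with rfl | rfl <;> rcases hj with rfl | rfl
        · exact absurd rfl hij
        · simpa using h01
        · simpa [real_inner_comm] using h01
        · exact absurd rfl hij)
  have b0 : b 0 = e₀ := by simpa using hb 0 (by simp)
  have b1 : b 1 = e₁ := by simpa using hb 1 (by simp)
  have r0 : b.repr e₀ = !₂[1, 0, 0] := by
    rw [← b0, b.repr_self]; ext i; fin_cases i <;> simp
  have r1 : b.repr e₁ = !₂[0, 1, 0] := by
    rw [← b1, b.repr_self]; ext i; fin_cases i <;> simp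
  refine ⟨(IsometryEquiv.subRight P₀).trans
    (b.repr.toIsometryEquiv.trans (IsometryEquiv.addLeft A)), ?_, ?_, ?_⟩
  · simp
  · simp only [IsometryEquiv.trans_apply, IsometryEquiv.subRight_apply,
      LinearIsometryEquiv.coe_toIsometryEquiv, IsometryEquiv.addLeft_apply]
    rw [← hw₁, hw₁e, map_smul, r0]
    congr 1
    ext i; fin_cases i <;> simp
  · simp only [IsometryEquiv.trans_apply, IsometryEquiv.subRight_apply,
      LinearIsometryEquiv.coe_toIsometryEquiv, IsometryEquiv.addLeft_apply]
    have : w₂ = α • e₀ + β • e₁ := by rw [← hye, hy]; abel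
    rw [← hw₂, this, map_add, b.repr.map_smul α e₀, b.repr.map_smul β e₁, r0, r1]
    congr 1
    ext i; fin_cases i <;> simp

/-- Triangles whose side lengths tend to `2 / √3` can be moved onto `A_0 A_1 A_2` in the limit. -/
theorem exists_isometries_tendsto_corner {P₀ P₁ P₂ : ℕ → Space}
    (h01 : Tendsto (fun n => dist (P₀ n) (P₁ n)) atTop (𝓝 (2 / √3)))
    (h02 : Tendsto (fun n => dist (P₀ n) (P₂ n)) atTop (𝓝 (2 / √3)))
    (h12 : Tendsto (fun n => dist (P₁ n) (P₂ n)) atTop (𝓝 (2 / √3))) :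
    ∃ Φ : ℕ → Space ≃ᵢ Space, Tendsto (fun n => Φ n (P₀ n)) atTop (𝓝 (corner 0)) ∧
      Tendsto (fun n => Φ n (P₁ n)) atTop (𝓝 (corner 1)) ∧
      Tendsto (fun n => Φ n (P₂ n)) atTop (𝓝 (corner 2)) := by
  have h3 : (√3 : ℝ) ^ 2 = 3 := Real.sq_sqrt (by norm_num)
  set r := fun n => dist (P₀ n) (P₁ n) with hr
  set d := fun n => dist (P₀ n) (P₂ n) with hd
  set α := fun n => (r n ^ 2 + d n ^ 2 - dist (P₁ n) (P₂ n) ^ 2) / (2 * r n) with hα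
  have hαlim : Tendsto α atTop (𝓝 (1 / √3)) := by
    have h : Tendsto α atTop
        (𝓝 (((2 / √3) ^ 2 + (2 / √3) ^ 2 - (2 / √3) ^ 2) / (2 * (2 / √3)))) :=
      (((h01.pow 2).add (h02.pow 2)).sub (h12.pow 2)).div (h01.const_mul 2) (by positivity)
    rwa [show ((2 / √3) ^ 2 + (2 / √3) ^ 2 - (2 / √3) ^ 2) / (2 * (2 / √3)) = 1 / √3 by
      field_simp; norm_num] at h
  have hβlim : Tendsto (fun n => √(d n ^ 2 - α n ^ 2)) atTop (𝓝 1) := by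
    have := ((h02.pow 2).sub (hαlim.pow 2)).sqrt
    convert this using 2
    rw [div_pow, div_pow, h3]
    norm_num
  have ev1 : ∀ᶠ n in atTop, 0 < r n := h01.eventually (lt_mem_nhds (by positivity))
  have ev2 : ∀ᶠ n in atTop, α n ^ 2 < d n ^ 2 := by
    refine (hαlim.pow 2).eventually_lt (h02.pow 2) ?_
    rw [div_pow, div_pow, h3]
    norm_num
  -- Degenerate triangles occur for finitely many `n` only, where any isometry serves.
  have hex : ∀ n, ∃ Φ : Space ≃ᵢ Space, 0 < r n → α n ^ 2 < d n ^ 2 →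
      Φ (P₀ n) = corner 0 ∧ Φ (P₁ n) = corner 0 + !₂[r n, 0, 0] ∧
      Φ (P₂ n) = corner 0 + !₂[α n, √(d n ^ 2 - α n ^ 2), 0] := by
    intro n
    by_cases hc : 0 < r n ∧ α n ^ 2 < d n ^ 2
    · obtain ⟨Φ, hΦ⟩ := exists_isometry_triangle (corner 0) (P₀ := P₀ n) (P₁ := P₁ n) (P₂ := P₂ n)
        (r := r n) (d := d n) (α := α n) rfl rfl hc.1
        (mul_div_cancel₀ _ (by have := hc.1; positivity)) hc.2
      exact ⟨Φ, fun _ _ => hΦ⟩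
    · exact ⟨IsometryEquiv.refl _, fun h1 h2 => absurd ⟨h1, h2⟩ hc⟩
  choose Φ hΦ using hex
  have c1 : corner 1 = corner 0 + !₂[2 / √3, 0, 0] := by
    simp only [corner]
    ext i; fin_cases i <;> simp
    ring
  have c2 : corner 2 = corner 0 + !₂[1 / √3, 1, 0] := by
    simp only [corner]
    ext i; fin_cases i <;> simp
    ring
  refine ⟨Φ, ?_, ?_, ?_⟩
  · refine tendsto_const_nhds.congr' ?_
    filter_upwards [ev1, ev2] with n h1 h2
    exact (hΦ n h1 h2).1.symm
  · rw [c1]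
    have hc : Continuous fun x : ℝ => corner 0 + (!₂[x, 0, 0] : Space) := by fun_prop
    refine ((hc.tendsto (2 / √3)).comp h01).congr' ?_
    filter_upwards [ev1, ev2] with n h1 h2
    exact (hΦ n h1 h2).2.1.symm
  · rw [c2]
    have hc : Continuous fun x : ℝ × ℝ => corner 0 + (!₂[x.1, x.2, 0] : Space) := by fun_prop
    refine ((hc.tendsto (1 / √3, 1)).comp (hαlim.prodMk_nhds hβlim)).congr' ?_
    filter_upwards [ev1, ev2] with n h1 h2
    exact (hΦ n h1 h2).2.2.symm

/-! ### Rigidity of nearly Lipschitz maps with prescribed vertices -/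

/-- The moment of inertia of a weighted triangle about an arbitrary point. -/
theorem weighted_sq_norm {V : Type*} [NormedAddCommGroup V] [InnerProductSpace ℝ V]
    (X x y z : V) {a b c : ℝ} (h : a + b + c = 1) :
    a * ‖X - x‖ ^ 2 + b * ‖X - y‖ ^ 2 + c * ‖X - z‖ ^ 2
      = ‖X - (a • x + b • y + c • z)‖ ^ 2
        + (a * b * ‖x - y‖ ^ 2 + b * c * ‖y - z‖ ^ 2 + a * c * ‖x - z‖ ^ 2) := by
  have e : X - (a • x + b • y + c • z) = a • (X - x) + b • (X - y) + c • (X - z) := by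
    have : X = (a + b + c) • X := by rw [h, one_smul]
    conv_lhs => rw [this]
    module
  have e1 : x - y = (X - y) - (X - x) := by abel
  have e2 : y - z = (X - z) - (X - y) := by abel
  have e3 : x - z = (X - z) - (X - x) := by abel
  rw [e, e1, e2, e3]
  set p := X - x
  set q := X - y
  set r := X - z
  simp only [norm_add_sq_real, norm_sub_sq_real, inner_add_left, real_inner_smul_left,
    real_inner_smul_right, norm_smul, mul_pow, Real.norm_eq_abs, sq_abs]
  rw [real_inner_comm p q, real_inner_comm p r, real_inner_comm q r]
  obtain rfl : c = 1 - a - b := by linarith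
  ring

theorem sq_norm_vertex_sub (j : ℤ) : ‖vertex j - vertex (j + 1)‖ ^ 2 = 4 / 3 ∧
    ‖vertex (j + 1) - vertex (j + 2)‖ ^ 2 = 4 / 3 ∧ ‖vertex j - vertex (j + 2)‖ ^ 2 = 4 / 3 := by
  have h3 : (√3 : ℝ) ^ 2 = 3 := Real.sq_sqrt (by norm_num)
  have hv : vertexHeight j = 0 ∨ vertexHeight j = 1 := by
    unfold vertexHeight; split_ifs <;> simp
  have e2 : vertexHeight (j + 2) = vertexHeight j := by
    rw [show j + 2 = (j + 1) + 1 by ring, vertexHeight_succ, vertexHeight_succ]; ring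
  simp only [EuclideanSpace.norm_sq_eq, Fin.sum_univ_two, vertex, e2, vertexHeight_succ,
    PiLp.sub_apply, Real.norm_eq_abs, sq_abs]
  have d1 : (j : ℝ) / √3 - (j + 1) / √3 = -(1 / √3) := by ring
  have d2 : ((j : ℝ) + 1) / √3 - (j + 2) / √3 = -(1 / √3) := by ring
  have d3 : (j : ℝ) / √3 - (j + 2) / √3 = -(2 / √3) := by ring
  rcases hv with hv | hv <;> simp [hv, d1, d2, d3, div_pow, h3] <;> norm_num

theorem sq_norm_corner_sub (j : ℤ) : ‖corner j - corner (j + 1)‖ ^ 2 = 4 / 3 ∧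
    ‖corner (j + 1) - corner (j + 2)‖ ^ 2 = 4 / 3 ∧ ‖corner j - corner (j + 2)‖ ^ 2 = 4 / 3 := by
  have h3 : ((√3 : ℝ)⁻¹) ^ 2 = 1 / 3 := by
    rw [inv_pow, Real.sq_sqrt (by norm_num)]; norm_num
  have hsq : ∀ x y z x' y' z' : ℝ, ‖(!₂[x, y, z] : Space) - !₂[x', y', z']‖ ^ 2
      = (x - x') ^ 2 + (y - y') ^ 2 + (z - z') ^ 2 := by
    intro x y z x' y' z'
    simp [EuclideanSpace.norm_sq_eq, Fin.sum_univ_three]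
  have hA : ∀ i k : ℤ, i % 3 ≠ k % 3 → ‖corner i - corner k‖ ^ 2 = 4 / 3 := by
    intro i k hik
    rcases (by omega : i % 3 = 0 ∨ i % 3 = 1 ∨ i % 3 = 2) with hi | hi | hi <;>
    rcases (by omega : k % 3 = 0 ∨ k % 3 = 1 ∨ k % 3 = 2) with hk | hk | hk <;>
    first
    | (exfalso; omega)
    | (simp only [corner, hi, hk, if_true, one_ne_zero, two_ne_zero, if_false,
        show ¬ ((2 : ℤ) = 1) by decide, hsq]
       first
       | linear_combination 4 * h3
       | linear_combination h3)
  exact ⟨hA _ _ (by omega), hA _ _ (by omega), hA _ _ (by omega)⟩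

/-- The triangles `v_j v_{j+1} v_{j+2}` cover the strip. -/
theorem exists_triangle_coordinates {p : Plane} (hp : p ∈ closedStrip) :
    ∃ (j : ℤ) (a b c : ℝ), 0 ≤ a ∧ 0 ≤ b ∧ 0 ≤ c ∧ a + b + c = 1 ∧
      p = a • vertex j + b • vertex (j + 1) + c • vertex (j + 2) := by
  have h3 : (0 : ℝ) < √3 := by positivity
  -- `√3 x - y` equals `2 k` along `v_{2k} v_{2k+1}` and `2 k + 2` along `v_{2k+2} v_{2k+3}`. So `k`
  -- selects a parallelogram, and the case distinction below tells on which side of its diagonal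
  -- `v_{2k+1} v_{2k+2}` the point lies.
  set k : ℤ := ⌊(√3 * p 0 - p 1) / 2⌋ with hk
  have k1 : (k : ℝ) ≤ (√3 * p 0 - p 1) / 2 := Int.floor_le _
  have k2 : (√3 * p 0 - p 1) / 2 < k + 1 := Int.lt_floor_add_one _
  have hp0 := hp.1
  have hp1 := hp.2
  by_cases hc : √3 * p 0 - 2 * k - p 1 ≤ 2 - 2 * p 1
  · have e0 : vertexHeight (2 * k) = 0 := by simp [vertexHeight]
    have e1 : vertexHeight (2 * k + 1) = 1 := by rw [vertexHeight_succ, e0]; norm_num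
    have e2 : vertexHeight (2 * k + 2) = 0 := by
      rw [show 2 * k + 2 = (2 * k + 1) + 1 by ring, vertexHeight_succ, e1]; norm_num
    refine ⟨2 * k, 1 - p 1 - (√3 * p 0 - 2 * k - p 1) / 2, p 1, (√3 * p 0 - 2 * k - p 1) / 2,
      by linarith, hp0, by linarith, by ring, ?_⟩
    ext i
    fin_cases i
    · simp [vertex]; field_simp; ring
    · simp [vertex, e0, e1, e2]
  · push Not at hc
    have e0 : vertexHeight (2 * k + 1) = 1 := by
      rw [vertexHeight_succ]; simp [vertexHeight]
    have e1 : vertexHeight (2 * k + 1 + 1) = 0 := by rw [vertexHeight_succ, e0]; norm_num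
    have e2 : vertexHeight (2 * k + 1 + 2) = 1 := by
      rw [show 2 * k + 1 + 2 = (2 * k + 1 + 1) + 1 by ring, vertexHeight_succ, e1]; norm_num
    refine ⟨2 * k + 1, p 1 - (√3 * p 0 - 2 * k - 2 + p 1) / 2, 1 - p 1,
      (√3 * p 0 - 2 * k - 2 + p 1) / 2, by linarith, by linarith, by linarith, by ring, ?_⟩
    ext i
    fin_cases i
    · simp [vertex]; field_simp; ring
    · simp [vertex, e0, e1, e2]

/-- A nearly `1`-Lipschitz map that nearly agrees with `stripMap` at the vertices of the
triangulation is uniformly close to it. -/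
theorem sq_dist_stripMap_le {G : Plane → Space} {K η : ℝ} (hK : 1 ≤ K) (hη : 0 ≤ η)
    (hG : ∀ p ∈ closedStrip, ∀ q ∈ closedStrip, dist (G p) (G q) ≤ K * dist p q)
    (hv : ∀ j, dist (G (vertex j)) (corner j) ≤ η) {p : Plane} (hp : p ∈ closedStrip) :
    dist (stripMap p) (G p) ^ 2 ≤ (K ^ 2 - 1) * 2 + K * η * 3 + η ^ 2 := by
  obtain ⟨j, a, b, c, ha, hb, hc, habc, hpe⟩ := exists_triangle_coordinates hp
  have hJ : stripMap p = a • corner j + b • corner (j + 1) + c • corner (j + 2) := by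
    rw [hpe]
    exact stripMap_affine j a b c ha hb hc habc
  have vmem : ∀ i, vertex i ∈ closedStrip := by
    intro i
    simp only [closedStrip, vertex, mem_ofPred_eq]
    unfold vertexHeight
    split_ifs <;> simp
  have hone : ∀ i, ‖G p - corner i‖ ^ 2
      ≤ K ^ 2 * ‖p - vertex i‖ ^ 2 + K * η * (1 + ‖p - vertex i‖ ^ 2) + η ^ 2 := by
    intro i
    have h1 := dist_triangle (G p) (G (vertex i)) (corner i)
    have h2 := hG p hp (vertex i) (vmem i)
    have h3 := hv i
    rw [← dist_eq_norm, ← dist_eq_norm]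
    have h4 : dist (G p) (corner i) ≤ K * dist p (vertex i) + η := by linarith
    have h5 := pow_le_pow_left₀ dist_nonneg h4 2
    have h6 : 0 ≤ K * η := by positivity
    nlinarith [mul_le_mul_of_nonneg_left (show 2 * dist p (vertex i)
      ≤ 1 + dist p (vertex i) ^ 2 by nlinarith [sq_nonneg (dist p (vertex i) - 1)]) h6]
  -- Both triangles have the same moment `D`. The weighted squared distances are `‖G p - stripMap
  -- p‖² + D` in space and exactly `D` in the plane; as the former hardly exceed the latter, the
  -- first term is small.
  have w1 := weighted_sq_norm (G p) (corner j) (corner (j + 1)) (corner (j + 2)) habc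
  have w2 := weighted_sq_norm p (vertex j) (vertex (j + 1)) (vertex (j + 2)) habc
  obtain ⟨s1, s2, s3⟩ := sq_norm_corner_sub j
  obtain ⟨t1, t2, t3⟩ := sq_norm_vertex_sub j
  rw [← hJ, s1, s2, s3] at w1
  rw [← hpe, sub_self, norm_zero, t1, t2, t3] at w2
  rw [dist_comm, dist_eq_norm]
  have m1 := mul_le_mul_of_nonneg_left (hone j) ha
  have m2 := mul_le_mul_of_nonneg_left (hone (j + 1)) hb
  have m3 := mul_le_mul_of_nonneg_left (hone (j + 2)) hc
  set D := a * b * (4 / 3) + b * c * (4 / 3) + a * c * (4 / 3) with hD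
  have hD2 : D ≤ 2 := by
    have : (a + b + c) ^ 2 = 1 := by rw [habc, one_pow]
    linarith [mul_nonneg ha hb, mul_nonneg hb hc, mul_nonneg ha hc, sq_nonneg a, sq_nonneg b,
      sq_nonneg c, show (a + b + c) ^ 2 = a ^ 2 + b ^ 2 + c ^ 2 + 2 * (a * b) + 2 * (b * c)
        + 2 * (a * c) by ring]
  have hw2 : a * ‖p - vertex j‖ ^ 2 + b * ‖p - vertex (j + 1)‖ ^ 2
      + c * ‖p - vertex (j + 2)‖ ^ 2 = D := by linarith
  have key : ‖G p - stripMap p‖ ^ 2 + D ≤ K ^ 2 * D + K * η * (1 + D) + η ^ 2 := by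
    rw [← w1]
    calc _ ≤ _ := add_le_add (add_le_add m1 m2) m3
      _ = K ^ 2 * (a * ‖p - vertex j‖ ^ 2 + b * ‖p - vertex (j + 1)‖ ^ 2
          + c * ‖p - vertex (j + 2)‖ ^ 2) + K * η * ((a + b + c)
          + (a * ‖p - vertex j‖ ^ 2 + b * ‖p - vertex (j + 1)‖ ^ 2
          + c * ‖p - vertex (j + 2)‖ ^ 2)) + (a + b + c) * η ^ 2 := by ring
      _ = _ := by rw [hw2, habc]; ring
  have n1 : 0 ≤ (K ^ 2 - 1) * (2 - D) :=
    mul_nonneg (by nlinarith) (by linarith)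
  have n2 : 0 ≤ K * η * (2 - D) := mul_nonneg (by positivity) (by linarith)
  linarith

/-! ### Convergence at the vertices -/

/-- The map of the strip of `M_√3` that a developing map of `M_lam` induces after a translation. -/
def rescale (lam a : ℝ) (F : Plane → Space) (p : Plane) : Space :=
  F !₂[lam / √3 * p 0 + a, p 1]

theorem dist_rescale_le {lam : ℝ} {F : Plane → Space} (h : IsDevelopingMap lam F) (a : ℝ) :
    ∀ p ∈ closedStrip, ∀ q ∈ closedStrip,
      dist (rescale lam a F p) (rescale lam a F q) ≤ max 1 (lam / √3) * dist p q := by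
  intro p hp q hq
  have hl := h.pos
  refine (h.lipschitz _ (by simpa [closedStrip] using hp) _
    (by simpa [closedStrip] using hq)).trans ?_
  set K := max 1 (lam / √3) with hK
  have hK1 : 1 ≤ K := le_max_left _ _
  have hK2 : lam / √3 ≤ K := le_max_right _ _
  have hmu : 0 ≤ lam / √3 := by positivity
  rw [EuclideanSpace.dist_eq, EuclideanSpace.dist_eq]
  refine Real.sqrt_le_iff.2 ⟨by positivity, ?_⟩
  rw [mul_pow, Real.sq_sqrt (by positivity)]
  simp only [Fin.sum_univ_two, Real.dist_eq, sq_abs]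
  simp only [Matrix.cons_val_zero, Matrix.cons_val_one]
  have e : lam / √3 * p 0 + a - (lam / √3 * q 0 + a) = lam / √3 * (p 0 - q 0) := by ring
  rw [e, mul_pow]
  have h1 : (lam / √3) ^ 2 ≤ K ^ 2 := pow_le_pow_left₀ hmu hK2 2
  have h2 : 1 ≤ K ^ 2 := one_le_pow₀ hK1
  nlinarith [mul_le_mul_of_nonneg_right h1 (sq_nonneg (p 0 - q 0)),
    mul_le_mul_of_nonneg_right h2 (sq_nonneg (p 1 - q 1))]

theorem rescale_vertex_add_three {lam : ℝ} {F : Plane → Space} (h : IsDevelopingMap lam F)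
    (a : ℝ) (j : ℤ) : rescale lam a F (vertex (j + 3)) = rescale lam a F (vertex j) := by
  have h3 : (√3 : ℝ) ^ 2 = 3 := Real.sq_sqrt (by norm_num)
  have hmem : (!₂[lam / √3 * vertex j 0 + a, vertex j 1] : Plane) ∈ closedStrip := by
    simp only [closedStrip, vertex, mem_ofPred_eq]
    unfold vertexHeight
    split_ifs <;> simp
  unfold rescale
  rw [← h.periodic _ hmem]
  congr 1
  ext i
  fin_cases i
  · simp [vertex]
    field_simp
    rw [h3]
    ring
  · simp [vertex, vertexHeight_add_three]

theorem tendsto_dist_of_close {P Q P' Q' : ℕ → Space} {l : ℝ}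
    (h : Tendsto (fun n => dist (P n) (Q n)) atTop (𝓝 l))
    (hP : Tendsto (fun n => dist (P n) (P' n)) atTop (𝓝 0))
    (hQ : Tendsto (fun n => dist (Q n) (Q' n)) atTop (𝓝 0)) :
    Tendsto (fun n => dist (P' n) (Q' n)) atTop (𝓝 l) := by
  have h0 : Tendsto (fun n => dist (P' n) (Q' n) - dist (P n) (Q n)) atTop (𝓝 0) := by
    refine squeeze_zero_norm (a := fun n => dist (P n) (P' n) + dist (Q n) (Q' n)) (fun n => ?_) ?_
    · rw [Real.norm_eq_abs, ← Real.dist_eq, dist_comm]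
      exact dist_dist_dist_le _ _ _ _
    · simpa using hP.add hQ
  simpa using h.add h0

/-- The images of the vertices of the triangulation, for a suitable translation of the strip. -/
theorem exists_shift_tendsto {lam : ℕ → ℝ} {F : ℕ → Plane → Space}
    (hF : ∀ n, IsDevelopingMap (lam n) (F n)) (hemb : ∀ n, IsEmbedded (lam n) (F n))
    (hlam : Tendsto lam atTop (𝓝 (√3))) :
    ∃ a : ℕ → ℝ, ∀ i k : Fin 3, i < k →
      Tendsto (fun n => dist (rescale (lam n) (a n) (F n) (vertex (i : ℕ)))
        (rescale (lam n) (a n) (F n) (vertex (k : ℕ)))) atTop (𝓝 (2 / √3)) := by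
  have h3 : (√3 : ℝ) ^ 2 = 3 := Real.sq_sqrt (by norm_num)
  choose a b c hac hcb hba hbend e he hperp hheight using fun n => (hF n).exists_triangle (hemb n)
  set T₀ := fun n => F n !₂[a n, 0] with hT₀
  set T₁ := fun n => F n !₂[b n, 1] with hT₁
  set Q := fun n => F n !₂[c n, 0] with hQ
  have bot : ∀ x : ℝ, (!₂[x, 0] : Plane) ∈ closedStrip := fun x => by simp [closedStrip]
  have top : ∀ x : ℝ, (!₂[x, 1] : Plane) ∈ closedStrip := fun x => by simp [closedStrip]
  have hbot : ∀ x y : ℝ, dist (!₂[x, 0] : Plane) !₂[y, 0] = |x - y| := fun x y => by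
    simp [EuclideanSpace.dist_eq, Real.dist_eq, Real.sqrt_sq_eq_abs]
  have htop : ∀ x y : ℝ, dist (!₂[x, 1] : Plane) !₂[y, 1] = |x - y| := fun x y => by
    simp [EuclideanSpace.dist_eq, Real.dist_eq, Real.sqrt_sq_eq_abs]
  -- Each end of the bend is seen on both edges of the strip. Hence the bottom arc from `a` to `b +
  -- lam`, of length `lam + t`, contains the apex, and the top arc from `b` to `a + lam` has length
  -- `lam - t`.
  have hT₁' : ∀ n, T₁ n = F n !₂[b n + lam n, 0] := fun n => by
    simp only [hT₁]
    rw [← (hF n).periodic _ (top (b n))]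
    simp
  have hT₀' : ∀ n, T₀ n = F n !₂[a n + lam n, 1] := fun n => by
    simp only [hT₀]
    rw [← (hF n).periodic _ (bot (a n))]
    simp
  have hd₀ : ∀ n, dist (T₀ n) (Q n) ≤ c n - a n := fun n => by
    have := (hF n).lipschitz _ (bot (a n)) _ (bot (c n))
    rwa [hbot, abs_sub_comm, abs_of_nonneg (by linarith [hac n])] at this
  have hd₁ : ∀ n, dist (T₁ n) (Q n) ≤ b n + lam n - c n := fun n => by
    have := (hF n).lipschitz _ (bot (b n + lam n)) _ (bot (c n))
    rwa [hbot, abs_of_nonneg (by linarith [hcb n]), ← hT₁'] at this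
  have hl : ∀ n, dist (T₀ n) (T₁ n) ≤ lam n - (b n - a n) := fun n => by
    have := (hF n).lipschitz _ (top (a n + lam n)) _ (top (b n))
    rw [htop, abs_of_nonneg (by linarith [hba n]), ← hT₀'] at this
    linarith
  have hlsq : ∀ n, dist (T₀ n) (T₁ n) ^ 2 = 1 + (b n - a n) ^ 2 := fun n => by
    have h1 : dist (T₀ n) (T₁ n) = dist (!₂[a n, 0] : Plane) !₂[b n, 1] := hbend n
    rw [h1, EuclideanSpace.dist_sq_eq]
    simp [Real.dist_eq]
    ring
  have nh : ∀ n (w : Space), |inner ℝ w (e n)| ≤ ‖w‖ := fun n w => by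
    simpa [he n] using abs_real_inner_le_norm w (e n)
  have hw1 : ∀ n, 1 ≤ dist (T₀ n) (Q n) := fun n => by
    rw [dist_comm, dist_eq_norm]
    exact (hheight n).trans ((le_abs_self _).trans (nh n _))
  have hw2 : ∀ n, 1 ≤ dist (T₁ n) (Q n) := fun n => by
    rw [dist_comm, dist_eq_norm]
    have e1 : Q n - T₁ n = (Q n - T₀ n) - (T₁ n - T₀ n) := by abel
    have e2 : 1 ≤ inner ℝ (Q n - T₁ n) (e n) := by
      rw [e1, inner_sub_left, hperp n, sub_zero]
      exact hheight n
    exact e2.trans ((le_abs_self _).trans (nh n _))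
  obtain ⟨ht, hlim, hd₀lim, hd₁lim⟩ := tendsto_triangle_shape (t := fun n => b n - a n)
    (l := fun n => dist (T₀ n) (T₁ n)) (d₀ := fun n => dist (T₀ n) (Q n))
    (d₁ := fun n => dist (T₁ n) (Q n)) hlam (fun n => (hF n).pos) (fun n => dist_nonneg) hw1 hw2
    hlsq hl (fun n => by linarith [hd₀ n, hd₁ n]) (fun n => by
      have := sq_norm_sub_norm_le (w := Q n - T₀ n) (w' := T₁ n - Q n) (he n)
        (by rw [show Q n - T₀ n + (T₁ n - Q n) = T₁ n - T₀ n by abel]; exact hperp n)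
        (hheight n)
      rw [show Q n - T₀ n + (T₁ n - Q n) = T₁ n - T₀ n by abel] at this
      simpa only [← dist_eq_norm, dist_comm (Q n) (T₀ n), dist_comm (T₁ n) (T₀ n)] using this)
  -- The position of the apex on the boundary is squeezed between `d₀` and `lam + t - d₁`, both of
  -- which tend to `2 / √3`.
  have hc : Tendsto (fun n => c n - a n) atTop (𝓝 (2 / √3)) := by
    refine tendsto_of_tendsto_of_tendsto_of_le_of_le (h := fun n => (b n - a n) + lam n
      - dist (T₁ n) (Q n)) hd₀lim ?_ hd₀ (fun n => by simp only; linarith [hd₁ n])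
    have := (ht.add hlam).sub hd₁lim
    convert this using 2
    field_simp
    rw [h3]
    norm_num
  have v0 : ∀ n, rescale (lam n) (a n) (F n) (vertex 0) = T₀ n := fun n => by
    simp [rescale, vertex, vertexHeight, hT₀]
  have v1 : ∀ n, rescale (lam n) (a n) (F n) (vertex 1) = F n !₂[lam n / 3 + a n, 1] := fun n => by
    have : lam n / √3 * (√3)⁻¹ = lam n / 3 := by field_simp; rw [h3]
    simp [rescale, vertex, vertexHeight, this]
  have v2 : ∀ n, rescale (lam n) (a n) (F n) (vertex 2) = F n !₂[2 * lam n / 3 + a n, 0] := by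
    intro n
    have : lam n / √3 * (2 / √3) = 2 * lam n / 3 := by field_simp; rw [h3]
    simp [rescale, vertex, vertexHeight, this]
  -- The rescaled vertices lie on the same edges as `(b, 1)` and `(c, 0)`, at distances tending to
  -- `0`, so the Lipschitz bound carries the limits over to their images.
  have close1 : Tendsto (fun n => dist (T₁ n) (rescale (lam n) (a n) (F n) (vertex 1))) atTop
      (𝓝 0) := by
    refine squeeze_zero (fun n => dist_nonneg) (g := fun n => |(b n - a n) - lam n / 3|)
      (fun n => ?_) ?_
    · rw [v1]
      have := (hF n).lipschitz _ (top (b n)) _ (top (lam n / 3 + a n))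
      rwa [htop, show b n - (lam n / 3 + a n) = b n - a n - lam n / 3 by ring] at this
    · have := (ht.sub (hlam.div_const 3)).abs
      rwa [show 1 / √3 - √3 / 3 = 0 by field_simp; rw [h3]; norm_num, abs_zero] at this
  have close2 : Tendsto (fun n => dist (Q n) (rescale (lam n) (a n) (F n) (vertex 2))) atTop
      (𝓝 0) := by
    refine squeeze_zero (fun n => dist_nonneg) (g := fun n => |(c n - a n) - 2 * lam n / 3|)
      (fun n => ?_) ?_
    · rw [v2]
      have := (hF n).lipschitz _ (bot (c n)) _ (bot (2 * lam n / 3 + a n))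
      rwa [hbot, show c n - (2 * lam n / 3 + a n) = c n - a n - 2 * lam n / 3 by ring] at this
    · have := (hc.sub ((hlam.const_mul 2).div_const 3)).abs
      rwa [show 2 / √3 - 2 * √3 / 3 = 0 by field_simp; rw [h3]; norm_num, abs_zero] at this
  have close0 : Tendsto (fun n => dist (T₀ n) (rescale (lam n) (a n) (F n) (vertex 0))) atTop
      (𝓝 0) := by
    simp only [v0, dist_self]
    exact tendsto_const_nhds
  refine ⟨a, fun i k hik => ?_⟩
  fin_cases i <;> fin_cases k <;> first
    | exact absurd hik (by decide)
    | skip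
  · exact tendsto_dist_of_close hlim close0 close1
  · exact tendsto_dist_of_close hd₀lim close0 close2
  · exact tendsto_dist_of_close hd₁lim close1 close2

end PaperMoebius

/-! ### Uniform convergence -/

theorem mainTheorem2
    (lam : ℕ → ℝ)
    (I : ∀ n : ℕ, PaperMoebius.FlatMoebius (lam n) → PaperMoebius.Space)
    (hI : ∀ n : ℕ, PaperMoebius.IsSmoothEmbeddedBand (lam n) (I n))
    (hlam : Tendsto lam atTop (𝓝 (√3))) :
    ∃ (Φ : ℕ → PaperMoebius.Space ≃ᵢ PaperMoebius.Space) (s : ℕ → ℤˣ) (c : ℕ → ℝ),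
      TendstoUniformly
        (fun (n : ℕ) (p : PaperMoebius.FlatMoebius (√3)) =>
          Φ n (I n (PaperMoebius.flatIsometry (lam n) (s n) (c n)
            (PaperMoebius.stretch (lam n) p))))
        PaperMoebius.triangularMap atTop := by
  open PaperMoebius in
  choose F hF hemb hFI using fun n => (hI n).exists_developingMap
  obtain ⟨a, ha⟩ := exists_shift_tendsto hF hemb hlam
  obtain ⟨Φ, hΦ0, hΦ1, hΦ2⟩ := exists_isometries_tendsto_corner
    (ha 0 1 (by decide)) (ha 0 2 (by decide)) (ha 1 2 (by decide))
  -- No reflection of the band is needed: `exists_triangle` always places the apex on the bottom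
  -- edge with `a ≤ c ≤ b + lam`, and `Φ` may reverse orientation.
  refine ⟨Φ, fun _ => 1, a, ?_⟩
  set G : ℕ → Plane → Space := fun n p => Φ n (rescale (lam n) (a n) (F n) p) with hG
  have hGI : ∀ n (p : Strip), Φ n (I n (flatIsometry (lam n) 1 (a n)
      (stretch (lam n) (proj (√3) p)))) = G n p.1 := by
    intro n p
    simp only [hG, rescale]
    have hy : (!₂[lam n / √3 * p.1 0 + a n, p.1 1] : Plane) ∈ closedStrip := by
      simpa [closedStrip] using p.2
    have := hFI n ⟨_, hy⟩
    simp only at this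
    rw [this]
    congr 2
    simp only [stretch, flatIsometry, proj]
    congr 1
    apply Subtype.ext
    simp [Strip.mk]
  set η : ℕ → ℝ := fun n => dist (G n (vertex 0)) (corner 0) + dist (G n (vertex 1)) (corner 1)
    + dist (G n (vertex 2)) (corner 2) with hη
  have hηlim : Tendsto η atTop (𝓝 0) := by
    have t0 := tendsto_iff_dist_tendsto_zero.1 hΦ0
    have t1 := tendsto_iff_dist_tendsto_zero.1 hΦ1
    have t2 := tendsto_iff_dist_tendsto_zero.1 hΦ2
    simpa using (t0.add t1).add t2
  -- Both the rescaled map on the vertices and `corner` have period `3` in `j`, so three errors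
  -- control them all.
  have hvert : ∀ n j, dist (G n (vertex j)) (corner j) ≤ η n := by
    intro n j
    have hper : Function.Periodic (fun j : ℤ => dist (G n (vertex j)) (corner j)) 3 := by
      intro j
      simp only [hG]
      rw [rescale_vertex_add_three (hF n)]
      congr 1
      simp [corner]
    have hmod : dist (G n (vertex j)) (corner j)
        = dist (G n (vertex (j % 3))) (corner (j % 3)) := by
      have := hper.sub_zsmul_eq (x := j) (j / 3)
      rw [show j - (j / 3) • (3 : ℤ) = j % 3 by rw [smul_eq_mul]; omega] at this
      exact this.symm
    rw [hmod]
    have n0 := dist_nonneg (x := G n (vertex 0)) (y := corner 0)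
    have n1 := dist_nonneg (x := G n (vertex 1)) (y := corner 1)
    have n2 := dist_nonneg (x := G n (vertex 2)) (y := corner 2)
    rcases (by omega : j % 3 = 0 ∨ j % 3 = 1 ∨ j % 3 = 2) with hj | hj | hj <;> rw [hj] <;>
      simp only [hη] <;> linarith
  set K : ℕ → ℝ := fun n => max 1 (lam n / √3) with hK
  have hKlim : Tendsto K atTop (𝓝 1) := by
    have h1 : Tendsto (fun n => lam n / √3) atTop (𝓝 1) := by
      have := hlam.div_const (√3)
      rwa [div_self (by positivity)] at this
    simpa using (tendsto_const_nhds (x := (1 : ℝ))).max h1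
  have hbound : Tendsto (fun n => (K n ^ 2 - 1) * 2 + K n * η n * 3 + η n ^ 2) atTop (𝓝 0) := by
    have := ((((hKlim.pow 2).sub_const 1).mul_const 2).add ((hKlim.mul hηlim).mul_const 3)).add
      (hηlim.pow 2)
    simpa using this
  rw [Metric.tendstoUniformly_iff]
  intro ε hε
  filter_upwards [hbound.eventually (gt_mem_nhds (show 0 < ε ^ 2 by positivity))] with n hn
  intro x
  induction x using Quot.ind with
  | mk p =>
    have h1 := hGI n p
    have h2 := sq_dist_stripMap_le (G := G n) (K := K n) (η := η n) (le_max_left _ _)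
      (by positivity) (fun p hp q hq => by
        simp only [hG, IsometryEquiv.dist_eq]
        exact dist_rescale_le (hF n) (a n) p hp q hq) (hvert n) (p := p.1) p.2
    have h3 : dist (stripMap p.1) (G n p.1) < ε :=
      lt_of_pow_lt_pow_left₀ 2 hε.le (h2.trans_lt hn)
    rw [← h1] at h3
    exact h3

end
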